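/- Let $T$ be a compact connected abelian Lie group and let $M$ be a smooth manifold with a smooth $T$-action and a $T$-equivariant stable complex structure, i.e. a smooth $T$-equivariant complex structure $J$ on the fibres of $TM\oplus\tau$, where $\tau=M\times\mathbb{R}^k$ is a product bundle with $T$ acting trivially on $\mathbb{R}^k$. Assume that the fixed point set $M^T$ has finitely many connected components. For a $T$-space $X$ let $K_T(X)$ denote the Grothendieck ring of $T$-equivariant complex vector bundles on $X$ (with sum $\oplus$ and product $\otimes$), which is an algebra over $K_T(\mathrm{pt})$ by pullback along $X\to\mathrm{pt}$, and let $\mathbb{Z}[T]$ be the integral group ring of the (abstract) group $T$. For a connected component $W$ of $M^T$ the normal bundle $\nu(W,M)=TM|_W/TW\cong (TM\oplus\tau)|_W/(TW\oplus\tau)$ is a $T$-equivariant complex vector bundle over $W$, where $T_pW\oplus\tau_p$ is the ($J$-invariant) subspace of $T$-fixed vectors of $T_pM\oplus\tau_p$. It is the direct sum of its nonzero isotypic components $I_\mu$, on which $T$ acts through continuous characters $\mu:T\to U(1)$. For a character $\mu$ and $t\in T$ let $a_\mu(t)\in[0,1)$ be the number with $\mu(t)=e^{2\pi i a_\mu(t)}$;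 then $a_\mu(t_1)+a_\mu(t_2)-a_\mu(t_1t_2)\in\{0,1\}$. For an equivariant bundle $E$ let $\epsilon(E)=\sum_{k\ge 0}(-1)^k[\Lambda^kE^*]$ be its $K$-theoretic Euler class. Then there is exactly one $\mathbb{Z}$-bilinear product $\star$ on $K_T(M^T)\otimes_{\mathbb Z}\mathbb{Z}[T]$ such that for all $\sigma_1,\sigma_2\in K_T(M^T)$, all $t_1,t_2\in T$ and every connected component $W$ of $M^T$ $$ \big((\sigma_1\otimes t_1)\star(\sigma_2\otimes t_2)\big)\big|_W=\Big[\sigma_1|_W\cdot\sigma_2|_W\cdot\prod_{I_\mu\subset\nu(W,M)}\epsilon(I_\mu)^{a_\mu(t_1)+a_\mu(t_2)-a_\mu(t_1t_2)}\Big]\otimes t_1t_2 $$ in $K_T(W)\otimes_{\mathbb Z}\mathbb{Z}[T]$, and $\star$ makes $K_T(M^T)\otimes_{\mathbb Z}\mathbb{Z}[T]$ a commutative, associative algebra over $K_T(\mathrm{pt})$ with unit $1\otimes 1$ (in particular $\star$ is $K_T(\mathrm{pt})$-bilinear). -/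

import Mathlib

open scoped TensorProduct Manifold ContDiff
namespace EquivK

noncomputable section

open Module

universe u v w

/-- A complex vector bundle over `X`, as a family of complex vector spaces with an atlas of
local frames: around each point `x₀` there is an open set `nhd x₀` over which the fibres are given
bases, and the changes of frame are continuous. The rank may vary from component to component. -/
structure VBundle (X : Type u) [TopologicalSpace X] where
  fib : X → Type
  [instAddCommGroup : ∀ x, AddCommGroup (fib x)]
  [instModule : ∀ x, Module ℂ (fib x)]
  nhd : X → Set X
  isOpen_nhd : ∀ x, IsOpen (nhd x)
  mem_nhd : ∀ x, x ∈ nhd x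
  idx : X → Type
  [instFinite : ∀ x, Finite (idx x)]
  frame : ∀ x₀ x, x ∈ nhd x₀ → Basis (idx x₀) ℂ (fib x)
  continuous_transition : ∀ x₀ x₁ j i,
    Continuous fun p : {p : X // p ∈ nhd x₀ ∧ p ∈ nhd x₁} =>
      (frame x₁ p.1 p.2.2).repr (frame x₀ p.1 p.2.1 j) i

attribute [instance] VBundle.instAddCommGroup VBundle.instModule VBundle.instFinite

/-- A family of linear maps `φ z : E_{a z} → F_{b z}` between fibres of bundles, parametrized by a
space `Z`, is continuous if its matrix entries in the local frames are continuous. -/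
def IsContFam {X : Type u} {Y : Type v} {Z : Type w} [TopologicalSpace X] [TopologicalSpace Y]
    [TopologicalSpace Z] (E : VBundle X) (F : VBundle Y) (a : Z → X) (b : Z → Y)
    (φ : ∀ z, E.fib (a z) →ₗ[ℂ] F.fib (b z)) : Prop :=
  ∀ x₀ y₁ j i, Continuous fun z : {z : Z // a z ∈ E.nhd x₀ ∧ b z ∈ F.nhd y₁} =>
    (F.frame y₁ (b z.1) z.2.2).repr (φ z.1 (E.frame x₀ (a z.1) z.2.1 j)) i

section ContFam

variable {X : Type*} {Y : Type*} {X' : Type*} {Z : Type*} {Z' : Type*} [TopologicalSpace X]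
  [TopologicalSpace Y] [TopologicalSpace X'] [TopologicalSpace Z] [TopologicalSpace Z']

theorem isContFam_id (E : VBundle X) : IsContFam E E id id (fun _ => LinearMap.id) :=
  fun x₀ x₁ j i => E.continuous_transition x₀ x₁ j i

theorem IsContFam.param {E : VBundle X} {F : VBundle Y} {a : Z → X} {b : Z → Y}
    {φ : ∀ z, E.fib (a z) →ₗ[ℂ] F.fib (b z)} (h : IsContFam E F a b φ) {g : Z' → Z}
    (hg : Continuous g) : IsContFam E F (a ∘ g) (b ∘ g) (fun z => φ (g z)) := by
  intro x₀ y₁ j i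
  exact (h x₀ y₁ j i).comp
    (f := fun z : {z : Z' // (a ∘ g) z ∈ E.nhd x₀ ∧ (b ∘ g) z ∈ F.nhd y₁} =>
      (⟨g z.1, z.2⟩ : {z : Z // a z ∈ E.nhd x₀ ∧ b z ∈ F.nhd y₁}))
    ((hg.comp continuous_subtype_val).subtype_mk _)

theorem IsContFam.comp {E : VBundle X} {F : VBundle Y} {G : VBundle X'} {a : Z → X} {b : Z → Y}
    {c : Z → X'} {φ : ∀ z, E.fib (a z) →ₗ[ℂ] F.fib (b z)}
    {ψ : ∀ z, F.fib (b z) →ₗ[ℂ] G.fib (c z)} (hψ : IsContFam F G b c ψ)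
    (hφ : IsContFam E F a b φ) (hb : Continuous b) :
    IsContFam E G a c (fun z => ψ z ∘ₗ φ z) := by
  intro x₀ y₁ j i
  refine continuous_iff_continuousAt.2 fun z₀ => ?_
  set f := fun z : {z : Z // a z ∈ E.nhd x₀ ∧ c z ∈ G.nhd y₁} =>
    (G.frame y₁ (c z.1) z.2.2).repr ((ψ z.1 ∘ₗ φ z.1) (E.frame x₀ (a z.1) z.2.1 j)) i with hf
  set O : Set {z : Z // a z ∈ E.nhd x₀ ∧ c z ∈ G.nhd y₁} := {z | b z.1 ∈ F.nhd (b z₀.1)} with hO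
  have hOo : IsOpen O := (F.isOpen_nhd _).preimage (hb.comp continuous_subtype_val)
  refine ContinuousOn.continuousAt (s := O) ?_ (hOo.mem_nhds (F.mem_nhd _))
  rw [continuousOn_iff_continuous_domRestrict]
  let _ := Fintype.ofFinite (F.idx (b z₀.1))
  have key : O.domRestrict f = fun z : O => ∑ k,
      (F.frame (b z₀.1) (b z.1.1) z.2).repr (φ z.1.1 (E.frame x₀ (a z.1.1) z.1.2.1 j)) k *
      (G.frame y₁ (c z.1.1) z.1.2.2).repr (ψ z.1.1 (F.frame (b z₀.1) (b z.1.1) z.2 k)) i := by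
    funext z
    change (G.frame y₁ (c z.1.1) z.1.2.2).repr
      (ψ z.1.1 (φ z.1.1 (E.frame x₀ (a z.1.1) z.1.2.1 j))) i = _
    conv_lhs => rw [← (F.frame (b z₀.1) (b z.1.1) z.2).sum_repr
      (φ z.1.1 (E.frame x₀ (a z.1.1) z.1.2.1 j))]
    simp only [map_sum, map_smul, Finsupp.finsetSum_apply, Finsupp.smul_apply, smul_eq_mul]
  rw [key]
  refine continuous_finsetSum _ fun k _ => Continuous.mul ?_ ?_
  · exact (hφ x₀ (b z₀.1) j k).comp
      (f := fun z : O => (⟨z.1.1, z.1.2.1, z.2⟩ :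
        {z : Z // a z ∈ E.nhd x₀ ∧ b z ∈ F.nhd (b z₀.1)}))
      ((continuous_subtype_val.comp continuous_subtype_val).subtype_mk _)
  · exact (hψ (b z₀.1) y₁ k i).comp
      (f := fun z : O => (⟨z.1.1, z.2, z.1.2.2⟩ :
        {z : Z // b z ∈ F.nhd (b z₀.1) ∧ c z ∈ G.nhd y₁}))
      ((continuous_subtype_val.comp continuous_subtype_val).subtype_mk _)

end ContFam

/-! ### Operations on vector bundles -/

namespace VBundle

variable {X : Type u} {Y : Type v} [TopologicalSpace X] [TopologicalSpace Y]

/-- The zero bundle. -/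
def zero (X : Type u) [TopologicalSpace X] : VBundle X where
  fib _ := PUnit
  nhd _ := Set.univ
  isOpen_nhd _ := isOpen_univ
  mem_nhd _ := trivial
  idx _ := Empty
  frame _ _ _ := Basis.empty _
  continuous_transition _ _ j := j.elim

/-- The product line bundle. -/
def one (X : Type u) [TopologicalSpace X] : VBundle X where
  fib _ := ℂ
  nhd _ := Set.univ
  isOpen_nhd _ := isOpen_univ
  mem_nhd _ := trivial
  idx _ := Unit
  frame _ _ _ := Basis.singleton Unit ℂ
  continuous_transition _ _ _ _ := continuous_const

theorem sum_transition (E F : VBundle X) {Z : Type*} [TopologicalSpace Z] {a b : Z → X}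
    {E' F' : VBundle X} {φ : ∀ z, E.fib (a z) →ₗ[ℂ] E'.fib (b z)}
    {ψ : ∀ z, F.fib (a z) →ₗ[ℂ] F'.fib (b z)} (hφ : IsContFam E E' a b φ)
    (hψ : IsContFam F F' a b ψ) (x₀ x₁) (j : E.idx x₀ ⊕ F.idx x₀) (i : E'.idx x₁ ⊕ F'.idx x₁) :
    Continuous fun z : {z : Z // a z ∈ E.nhd x₀ ∩ F.nhd x₀ ∧ b z ∈ E'.nhd x₁ ∩ F'.nhd x₁} =>
      ((E'.frame x₁ (b z.1) z.2.2.1).prod (F'.frame x₁ (b z.1) z.2.2.2)).repr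
        ((φ z.1).prodMap (ψ z.1)
          ((E.frame x₀ (a z.1) z.2.1.1).prod (F.frame x₀ (a z.1) z.2.1.2) j)) i := by
  rcases j with j | j <;> rcases i with i | i <;>
    simp only [Basis.prod_repr_inl, Basis.prod_repr_inr, LinearMap.prodMap_apply,
      Basis.prod_apply_inl_fst, Basis.prod_apply_inl_snd, Basis.prod_apply_inr_fst,
      Basis.prod_apply_inr_snd, map_zero, Finsupp.coe_zero, Pi.zero_apply]
  · exact (hφ x₀ x₁ j i).comp
      (f := fun z : {z : Z // a z ∈ E.nhd x₀ ∩ F.nhd x₀ ∧ b z ∈ E'.nhd x₁ ∩ F'.nhd x₁} =>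
        (⟨z.1, z.2.1.1, z.2.2.1⟩ : {z : Z // a z ∈ E.nhd x₀ ∧ b z ∈ E'.nhd x₁}))
      (continuous_subtype_val.subtype_mk _)
  · exact continuous_const
  · exact continuous_const
  · exact (hψ x₀ x₁ j i).comp
      (f := fun z : {z : Z // a z ∈ E.nhd x₀ ∩ F.nhd x₀ ∧ b z ∈ E'.nhd x₁ ∩ F'.nhd x₁} =>
        (⟨z.1, z.2.1.2, z.2.2.2⟩ : {z : Z // a z ∈ F.nhd x₀ ∧ b z ∈ F'.nhd x₁}))
      (continuous_subtype_val.subtype_mk _)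

/-- The direct sum of vector bundles. -/
def sum (E F : VBundle X) : VBundle X where
  fib x := E.fib x × F.fib x
  nhd x := E.nhd x ∩ F.nhd x
  isOpen_nhd x := (E.isOpen_nhd x).inter (F.isOpen_nhd x)
  mem_nhd x := ⟨E.mem_nhd x, F.mem_nhd x⟩
  idx x := E.idx x ⊕ F.idx x
  frame x₀ x h := (E.frame x₀ x h.1).prod (F.frame x₀ x h.2)
  continuous_transition x₀ x₁ j i := by
    simpa using sum_transition E F (isContFam_id E) (isContFam_id F) x₀ x₁ j i

theorem _root_.EquivK.IsContFam.prodMap {E F : VBundle X} {Z : Type*} [TopologicalSpace Z]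
    {a b : Z → X} {E' F' : VBundle X} {φ : ∀ z, E.fib (a z) →ₗ[ℂ] E'.fib (b z)}
    {ψ : ∀ z, F.fib (a z) →ₗ[ℂ] F'.fib (b z)} (hφ : IsContFam E E' a b φ)
    (hψ : IsContFam F F' a b ψ) :
    IsContFam (E.sum F) (E'.sum F') a b (fun z => (φ z).prodMap (ψ z)) :=
  fun x₀ x₁ j i => sum_transition E F hφ hψ x₀ x₁ j i

theorem tensor_transition (E F : VBundle X) {Z : Type*} [TopologicalSpace Z] {a b : Z → X}
    {E' F' : VBundle X} {φ : ∀ z, E.fib (a z) →ₗ[ℂ] E'.fib (b z)}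
    {ψ : ∀ z, F.fib (a z) →ₗ[ℂ] F'.fib (b z)} (hφ : IsContFam E E' a b φ)
    (hψ : IsContFam F F' a b ψ) (x₀ x₁) (j : E.idx x₀ × F.idx x₀) (i : E'.idx x₁ × F'.idx x₁) :
    Continuous fun z : {z : Z // a z ∈ E.nhd x₀ ∩ F.nhd x₀ ∧ b z ∈ E'.nhd x₁ ∩ F'.nhd x₁} =>
      ((E'.frame x₁ (b z.1) z.2.2.1).tensorProduct (F'.frame x₁ (b z.1) z.2.2.2)).repr
        (TensorProduct.map (φ z.1) (ψ z.1)
          ((E.frame x₀ (a z.1) z.2.1.1).tensorProduct (F.frame x₀ (a z.1) z.2.1.2) j)) i := by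
  obtain ⟨j, j'⟩ := j
  obtain ⟨i, i'⟩ := i
  simp only [Basis.tensorProduct_apply, TensorProduct.map_tmul,
    Basis.tensorProduct_repr_tmul_apply, smul_eq_mul]
  refine Continuous.mul ?_ ?_
  · exact (hψ x₀ x₁ j' i').comp
      (f := fun z : {z : Z // a z ∈ E.nhd x₀ ∩ F.nhd x₀ ∧ b z ∈ E'.nhd x₁ ∩ F'.nhd x₁} =>
        (⟨z.1, z.2.1.2, z.2.2.2⟩ : {z : Z // a z ∈ F.nhd x₀ ∧ b z ∈ F'.nhd x₁}))
      (continuous_subtype_val.subtype_mk _)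
  · exact (hφ x₀ x₁ j i).comp
      (f := fun z : {z : Z // a z ∈ E.nhd x₀ ∩ F.nhd x₀ ∧ b z ∈ E'.nhd x₁ ∩ F'.nhd x₁} =>
        (⟨z.1, z.2.1.1, z.2.2.1⟩ : {z : Z // a z ∈ E.nhd x₀ ∧ b z ∈ E'.nhd x₁}))
      (continuous_subtype_val.subtype_mk _)

/-- The tensor product of vector bundles. -/
def tensor (E F : VBundle X) : VBundle X where
  fib x := E.fib x ⊗[ℂ] F.fib x
  nhd x := E.nhd x ∩ F.nhd x
  isOpen_nhd x := (E.isOpen_nhd x).inter (F.isOpen_nhd x)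
  mem_nhd x := ⟨E.mem_nhd x, F.mem_nhd x⟩
  idx x := E.idx x × F.idx x
  frame x₀ x h := (E.frame x₀ x h.1).tensorProduct (F.frame x₀ x h.2)
  continuous_transition x₀ x₁ j i := by
    simpa using tensor_transition E F (isContFam_id E) (isContFam_id F) x₀ x₁ j i

theorem _root_.EquivK.IsContFam.tensorMap {E F : VBundle X} {Z : Type*} [TopologicalSpace Z]
    {a b : Z → X} {E' F' : VBundle X} {φ : ∀ z, E.fib (a z) →ₗ[ℂ] E'.fib (b z)}
    {ψ : ∀ z, F.fib (a z) →ₗ[ℂ] F'.fib (b z)} (hφ : IsContFam E E' a b φ)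
    (hψ : IsContFam F F' a b ψ) :
    IsContFam (E.tensor F) (E'.tensor F') a b (fun z => TensorProduct.map (φ z) (ψ z)) :=
  fun x₀ x₁ j i => tensor_transition E F hφ hψ x₀ x₁ j i

open Classical in
/-- The dual of a vector bundle. -/
def dual (E : VBundle X) : VBundle X where
  fib x := Module.Dual ℂ (E.fib x)
  nhd := E.nhd
  isOpen_nhd := E.isOpen_nhd
  mem_nhd := E.mem_nhd
  idx := E.idx
  frame x₀ x h := (E.frame x₀ x h).dualBasis
  continuous_transition x₀ x₁ j i := by
    simp only [Basis.dualBasis_repr, Basis.dualBasis_apply]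
    exact (E.continuous_transition x₁ x₀ i j).comp
      (f := fun p : {p : X // p ∈ E.nhd x₀ ∧ p ∈ E.nhd x₁} =>
        (⟨p.1, p.2.2, p.2.1⟩ : {p : X // p ∈ E.nhd x₁ ∧ p ∈ E.nhd x₀}))
      (continuous_subtype_val.subtype_mk _)

theorem _root_.EquivK.IsContFam.dualMap {E : VBundle X} {F : VBundle X} {Z : Type*}
    [TopologicalSpace Z] {a b : Z → X} {φ : ∀ z, E.fib (a z) →ₗ[ℂ] F.fib (b z)}
    (hφ : IsContFam E F a b φ) :
    IsContFam F.dual E.dual b a (fun z => (φ z).dualMap) := by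
  classical
  intro x₀ x₁ j i
  have h : ∀ z : {z : Z // b z ∈ F.dual.nhd x₀ ∧ a z ∈ E.dual.nhd x₁},
      (E.dual.frame x₁ (a z.1) z.2.2).repr ((φ z.1).dualMap (F.dual.frame x₀ (b z.1) z.2.1 j)) i
      = (F.frame x₀ (b z.1) z.2.1).repr (φ z.1 (E.frame x₁ (a z.1) z.2.2 i)) j := by
    intro z
    refine (Basis.dualBasis_repr (E.frame x₁ (a z.1) z.2.2) _ i).trans ?_
    exact Basis.dualBasis_apply (F.frame x₀ (b z.1) z.2.1) j _
  refine Continuous.congr ?_ fun z => (h z).symm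
  exact (hφ x₁ x₀ i j).comp
    (f := fun z : {z : Z // b z ∈ F.dual.nhd x₀ ∧ a z ∈ E.dual.nhd x₁} =>
      (⟨z.1, z.2.2, z.2.1⟩ : {z : Z // a z ∈ E.nhd x₁ ∧ b z ∈ F.nhd x₀}))
    (continuous_subtype_val.subtype_mk _)

/-- An auxiliary linear order on the index set of a frame. -/
abbrev idxOrder (E : VBundle X) (x : X) : LinearOrder (E.idx x) :=
  LinearOrder.lift' (Finite.equivFin (E.idx x)) (Finite.equivFin (E.idx x)).injective

attribute [local instance] idxOrder

theorem ext_transition (E : VBundle X) (n : ℕ) {Z : Type*} [TopologicalSpace Z] {a b : Z → X}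
    {E' : VBundle X} {φ : ∀ z, E.fib (a z) →ₗ[ℂ] E'.fib (b z)} (hφ : IsContFam E E' a b φ) (x₀ x₁)
    (j : Set.powersetCard (E.idx x₀) n) (i : Set.powersetCard (E'.idx x₁) n) :
    Continuous fun z : {z : Z // a z ∈ E.nhd x₀ ∧ b z ∈ E'.nhd x₁} =>
      ((E'.frame x₁ (b z.1) z.2.2).exteriorPower n).repr
        (exteriorPower.map n (φ z.1) ((E.frame x₀ (a z.1) z.2.1).exteriorPower n j)) i := by
  simp only [exteriorPower.basis_repr_apply, exteriorPower.basis_apply,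
    exteriorPower.map_apply_ιMulti_family]
  simp only [exteriorPower.ιMulti_family, exteriorPower.ιMultiDual_apply_ιMulti]
  refine Continuous.matrix_det ?_
  refine continuous_matrix fun k l => ?_
  exact hφ x₀ x₁ _ _

/-- The exterior powers of a vector bundle. -/
def ext (E : VBundle X) (n : ℕ) : VBundle X where
  fib x := ⋀[ℂ]^n (E.fib x)
  nhd := E.nhd
  isOpen_nhd := E.isOpen_nhd
  mem_nhd := E.mem_nhd
  idx x := Set.powersetCard (E.idx x) n
  frame x₀ x h := (E.frame x₀ x h).exteriorPower n
  continuous_transition x₀ x₁ j i := by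
    simpa using ext_transition E n (isContFam_id E) x₀ x₁ j i

theorem _root_.EquivK.IsContFam.extMap {E E' : VBundle X} (n : ℕ) {Z : Type*} [TopologicalSpace Z]
    {a b : Z → X} {φ : ∀ z, E.fib (a z) →ₗ[ℂ] E'.fib (b z)} (hφ : IsContFam E E' a b φ) :
    IsContFam (E.ext n) (E'.ext n) a b (fun z => exteriorPower.map n (φ z)) :=
  fun x₀ x₁ j i => ext_transition E n hφ x₀ x₁ j i

/-- The pullback of a vector bundle along a continuous map. -/
def pullback (E : VBundle X) (f : Y → X) (hf : Continuous f) : VBundle Y where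
  fib y := E.fib (f y)
  nhd y := f ⁻¹' E.nhd (f y)
  isOpen_nhd _ := (E.isOpen_nhd _).preimage hf
  mem_nhd _ := E.mem_nhd _
  idx y := E.idx (f y)
  frame y₀ y h := E.frame (f y₀) (f y) h
  continuous_transition y₀ y₁ j i :=
    ((isContFam_id E).param hf) (f y₀) (f y₁) j i

end VBundle

/-! ### Continuity of the structural maps -/

namespace IsContFam

variable {X : Type u} [TopologicalSpace X] {Y : Type v} [TopologicalSpace Y] {Z : Type w}
  [TopologicalSpace Z]

theorem congr {E : VBundle X} {F : VBundle Y} {a : Z → X} {b : Z → Y}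
    {φ ψ : ∀ z, E.fib (a z) →ₗ[ℂ] F.fib (b z)} (h : IsContFam E F a b φ) (e : ∀ z, φ z = ψ z) :
    IsContFam E F a b ψ := by
  obtain rfl : φ = ψ := funext e
  exact h

theorem fst (E F : VBundle X) :
    IsContFam (E.sum F) E id id (fun x => LinearMap.fst ℂ (E.fib x) (F.fib x)) := by
  intro x₀ x₁ j i
  rcases j with j | j
  · exact (E.continuous_transition x₀ x₁ j i).comp
      (f := fun z : {z : X // z ∈ E.nhd x₀ ∩ F.nhd x₀ ∧ z ∈ E.nhd x₁} =>
        (⟨z.1, z.2.1.1, z.2.2⟩ : {z : X // z ∈ E.nhd x₀ ∧ z ∈ E.nhd x₁}))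
      (continuous_subtype_val.subtype_mk _) |>.congr fun z => by
        change _ = (E.frame x₁ z.1 z.2.2).repr
          (((E.frame x₀ z.1 z.2.1.1).prod (F.frame x₀ z.1 z.2.1.2) (Sum.inl j)).1) i
        rw [Basis.prod_apply_inl_fst]
        rfl
  · refine (continuous_const (y := (0 : ℂ))).congr fun z => ?_
    change _ = (E.frame x₁ z.1 z.2.2).repr
      (((E.frame x₀ z.1 z.2.1.1).prod (F.frame x₀ z.1 z.2.1.2) (Sum.inr j)).1) i
    rw [Basis.prod_apply_inr_fst]
    simp

theorem snd (E F : VBundle X) :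
    IsContFam (E.sum F) F id id (fun x => LinearMap.snd ℂ (E.fib x) (F.fib x)) := by
  intro x₀ x₁ j i
  rcases j with j | j
  · refine (continuous_const (y := (0 : ℂ))).congr fun z => ?_
    change _ = (F.frame x₁ z.1 z.2.2).repr
      (((E.frame x₀ z.1 z.2.1.1).prod (F.frame x₀ z.1 z.2.1.2) (Sum.inl j)).2) i
    rw [Basis.prod_apply_inl_snd]
    simp
  · exact (F.continuous_transition x₀ x₁ j i).comp
      (f := fun z : {z : X // z ∈ E.nhd x₀ ∩ F.nhd x₀ ∧ z ∈ F.nhd x₁} =>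
        (⟨z.1, z.2.1.2, z.2.2⟩ : {z : X // z ∈ F.nhd x₀ ∧ z ∈ F.nhd x₁}))
      (continuous_subtype_val.subtype_mk _) |>.congr fun z => by
        change _ = (F.frame x₁ z.1 z.2.2).repr
          (((E.frame x₀ z.1 z.2.1.1).prod (F.frame x₀ z.1 z.2.1.2) (Sum.inr j)).2) i
        rw [Basis.prod_apply_inr_snd]
        rfl

theorem pair {G : VBundle Y} {E F : VBundle X} {a : Z → Y} {b : Z → X}
    {φ : ∀ z, G.fib (a z) →ₗ[ℂ] E.fib (b z)} {ψ : ∀ z, G.fib (a z) →ₗ[ℂ] F.fib (b z)}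
    (hφ : IsContFam G E a b φ) (hψ : IsContFam G F a b ψ) :
    IsContFam G (E.sum F) a b (fun z => (φ z).prod (ψ z)) := by
  intro x₀ x₁ j i
  rcases i with i | i
  · exact (hφ x₀ x₁ j i).comp
      (f := fun z : {z : Z // a z ∈ G.nhd x₀ ∧ b z ∈ E.nhd x₁ ∩ F.nhd x₁} =>
        (⟨z.1, z.2.1, z.2.2.1⟩ : {z : Z // a z ∈ G.nhd x₀ ∧ b z ∈ E.nhd x₁}))
      (continuous_subtype_val.subtype_mk _)
  · exact (hψ x₀ x₁ j i).comp
      (f := fun z : {z : Z // a z ∈ G.nhd x₀ ∧ b z ∈ E.nhd x₁ ∩ F.nhd x₁} =>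
        (⟨z.1, z.2.1, z.2.2.2⟩ : {z : Z // a z ∈ G.nhd x₀ ∧ b z ∈ F.nhd x₁}))
      (continuous_subtype_val.subtype_mk _)

theorem zero (E : VBundle X) (F : VBundle Y) (a : Z → X) (b : Z → Y) :
    IsContFam E F a b (fun _ => 0) := by
  intro x₀ x₁ j i
  refine (continuous_const (y := (0 : ℂ))).congr fun z => ?_
  simp

theorem add {E : VBundle X} {F : VBundle Y} {a : Z → X} {b : Z → Y}
    {φ ψ : ∀ z, E.fib (a z) →ₗ[ℂ] F.fib (b z)} (hφ : IsContFam E F a b φ)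
    (hψ : IsContFam E F a b ψ) : IsContFam E F a b (fun z => φ z + ψ z) := by
  intro x₀ x₁ j i
  refine ((hφ x₀ x₁ j i).add (hψ x₀ x₁ j i)).congr fun z => ?_
  simp

theorem smul {E : VBundle X} {F : VBundle Y} {a : Z → X} {b : Z → Y}
    {φ : ∀ z, E.fib (a z) →ₗ[ℂ] F.fib (b z)} (c : ℂ) (hφ : IsContFam E F a b φ) :
    IsContFam E F a b (fun z => c • φ z) := by
  intro x₀ x₁ j i
  refine ((hφ x₀ x₁ j i).const_mul c).congr fun z => ?_
  simp

theorem inl (E F : VBundle X) :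
    IsContFam E (E.sum F) id id (fun x => LinearMap.inl ℂ (E.fib x) (F.fib x)) :=
  (isContFam_id E).pair (zero E F id id)

theorem inr (E F : VBundle X) :
    IsContFam F (E.sum F) id id (fun x => LinearMap.inr ℂ (E.fib x) (F.fib x)) :=
  (zero F E id id).pair (isContFam_id F)

theorem coprod {G : VBundle Y} {E F : VBundle X} {a : X → Y}
    {φ : ∀ z, E.fib z →ₗ[ℂ] G.fib (a z)} {ψ : ∀ z, F.fib z →ₗ[ℂ] G.fib (a z)}
    (hφ : IsContFam E G id a φ) (hψ : IsContFam F G id a ψ) :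
    IsContFam (E.sum F) G id a (fun z => (φ z).coprod (ψ z)) :=
  (hφ.comp (fst E F) continuous_id).add (hψ.comp (snd E F) continuous_id)

theorem tensorComm (E F : VBundle X) : IsContFam (E.tensor F) (F.tensor E) id id
    (fun x => (TensorProduct.comm ℂ (E.fib x) (F.fib x)).toLinearMap) := by
  rintro x₀ x₁ ⟨j, j'⟩ ⟨i', i⟩
  refine ((isContFam_id E).tensorMap (isContFam_id F) x₀ x₁ (j, j') (i, i')).comp
    (f := fun z : {z : X // z ∈ E.nhd x₀ ∩ F.nhd x₀ ∧ z ∈ F.nhd x₁ ∩ E.nhd x₁} =>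
      (⟨z.1, z.2.1, z.2.2.2, z.2.2.1⟩ :
        {z : X // z ∈ E.nhd x₀ ∩ F.nhd x₀ ∧ z ∈ E.nhd x₁ ∩ F.nhd x₁}))
    (continuous_subtype_val.subtype_mk _) |>.congr fun z => ?_
  change ((E.frame x₁ z.1 z.2.2.2).tensorProduct (F.frame x₁ z.1 z.2.2.1)).repr
      (TensorProduct.map LinearMap.id LinearMap.id
        ((E.frame x₀ z.1 z.2.1.1).tensorProduct (F.frame x₀ z.1 z.2.1.2) (j, j'))) (i, i') =
    ((F.frame x₁ z.1 z.2.2.1).tensorProduct (E.frame x₁ z.1 z.2.2.2)).repr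
      (TensorProduct.comm ℂ _ _
        ((E.frame x₀ z.1 z.2.1.1).tensorProduct (F.frame x₀ z.1 z.2.1.2) (j, j'))) (i', i)
  simp [mul_comm]

theorem lid (E : VBundle X) : IsContFam ((VBundle.one X).tensor E) E id id
    (fun x => (TensorProduct.lid ℂ (E.fib x)).toLinearMap) := by
  rintro x₀ x₁ ⟨k, j⟩ i
  refine (E.continuous_transition x₀ x₁ j i).comp
    (f := fun z : {z : X // z ∈ Set.univ ∩ E.nhd x₀ ∧ z ∈ E.nhd x₁} =>
      (⟨z.1, z.2.1.2, z.2.2⟩ : {z : X // z ∈ E.nhd x₀ ∧ z ∈ E.nhd x₁}))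
    (continuous_subtype_val.subtype_mk _) |>.congr fun z => ?_
  have key : ∀ k : Unit, (E.frame x₁ z.1 z.2.2).repr (E.frame x₀ z.1 z.2.1.2 j) i =
      (E.frame x₁ z.1 z.2.2).repr (TensorProduct.lid ℂ _
        ((Basis.singleton Unit ℂ).tensorProduct (E.frame x₀ z.1 z.2.1.2) (k, j))) i := by
    intro k
    rw [Basis.tensorProduct_apply, TensorProduct.lid_tmul, Basis.singleton_apply, one_smul]
  exact key k

theorem lid_symm (E : VBundle X) : IsContFam E ((VBundle.one X).tensor E) id id
    (fun x => (TensorProduct.lid ℂ (E.fib x)).symm.toLinearMap) := by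
  rintro x₀ x₁ j ⟨k, i⟩
  refine (E.continuous_transition x₀ x₁ j i).comp
    (f := fun z : {z : X // z ∈ E.nhd x₀ ∧ z ∈ Set.univ ∩ E.nhd x₁} =>
      (⟨z.1, z.2.1, z.2.2.2⟩ : {z : X // z ∈ E.nhd x₀ ∧ z ∈ E.nhd x₁}))
    (continuous_subtype_val.subtype_mk _) |>.congr fun z => ?_
  have key : ∀ k : Unit, (E.frame x₁ z.1 z.2.2.2).repr (E.frame x₀ z.1 z.2.1 j) i =
      ((Basis.singleton Unit ℂ).tensorProduct (E.frame x₁ z.1 z.2.2.2)).repr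
        ((TensorProduct.lid ℂ _).symm (E.frame x₀ z.1 z.2.1 j)) (k, i) := by
    intro k
    rw [TensorProduct.lid_symm_apply, Basis.tensorProduct_repr_tmul_apply,
      Basis.singleton_repr, smul_eq_mul, mul_one]
  exact key k

theorem assoc (E F G : VBundle X) :
    IsContFam ((E.tensor F).tensor G) (E.tensor (F.tensor G)) id id
      (fun x => (TensorProduct.assoc ℂ (E.fib x) (F.fib x) (G.fib x)).toLinearMap) := by
  rintro x₀ x₁ ⟨⟨j, k⟩, l⟩ ⟨j', k', l'⟩
  refine (((isContFam_id E).tensorMap (isContFam_id F)).tensorMap (isContFam_id G)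
    x₀ x₁ ((j, k), l) ((j', k'), l')).comp
    (f := fun z : {z : X // z ∈ (E.nhd x₀ ∩ F.nhd x₀) ∩ G.nhd x₀ ∧
        z ∈ E.nhd x₁ ∩ (F.nhd x₁ ∩ G.nhd x₁)} =>
      (⟨z.1, z.2.1, ⟨z.2.2.1, z.2.2.2.1⟩, z.2.2.2.2⟩ :
        {z : X // z ∈ (E.nhd x₀ ∩ F.nhd x₀) ∩ G.nhd x₀ ∧
          z ∈ (E.nhd x₁ ∩ F.nhd x₁) ∩ G.nhd x₁}))
    (continuous_subtype_val.subtype_mk _) |>.congr fun z => ?_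
  change (((E.frame x₁ z.1 z.2.2.1).tensorProduct (F.frame x₁ z.1 z.2.2.2.1)).tensorProduct
      (G.frame x₁ z.1 z.2.2.2.2)).repr
      (TensorProduct.map (TensorProduct.map LinearMap.id LinearMap.id) LinearMap.id
        (((E.frame x₀ z.1 z.2.1.1.1).tensorProduct (F.frame x₀ z.1 z.2.1.1.2)).tensorProduct
          (G.frame x₀ z.1 z.2.1.2) ((j, k), l))) ((j', k'), l') =
    ((E.frame x₁ z.1 z.2.2.1).tensorProduct ((F.frame x₁ z.1 z.2.2.2.1).tensorProduct
      (G.frame x₁ z.1 z.2.2.2.2))).repr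
      (TensorProduct.assoc ℂ _ _ _
        (((E.frame x₀ z.1 z.2.1.1.1).tensorProduct (F.frame x₀ z.1 z.2.1.1.2)).tensorProduct
          (G.frame x₀ z.1 z.2.1.2) ((j, k), l))) (j', k', l')
  simp [mul_assoc]

theorem assoc_symm (E F G : VBundle X) :
    IsContFam (E.tensor (F.tensor G)) ((E.tensor F).tensor G) id id
      (fun x => (TensorProduct.assoc ℂ (E.fib x) (F.fib x) (G.fib x)).symm.toLinearMap) := by
  rintro x₀ x₁ ⟨j, k, l⟩ ⟨⟨j', k'⟩, l'⟩
  refine ((isContFam_id E).tensorMap ((isContFam_id F).tensorMap (isContFam_id G))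
    x₀ x₁ (j, k, l) (j', k', l')).comp
    (f := fun z : {z : X // z ∈ E.nhd x₀ ∩ (F.nhd x₀ ∩ G.nhd x₀) ∧
        z ∈ (E.nhd x₁ ∩ F.nhd x₁) ∩ G.nhd x₁} =>
      (⟨z.1, z.2.1, z.2.2.1.1, z.2.2.1.2, z.2.2.2⟩ :
        {z : X // z ∈ E.nhd x₀ ∩ (F.nhd x₀ ∩ G.nhd x₀) ∧
          z ∈ E.nhd x₁ ∩ (F.nhd x₁ ∩ G.nhd x₁)}))
    (continuous_subtype_val.subtype_mk _) |>.congr fun z => ?_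
  change ((E.frame x₁ z.1 z.2.2.1.1).tensorProduct ((F.frame x₁ z.1 z.2.2.1.2).tensorProduct
      (G.frame x₁ z.1 z.2.2.2))).repr
      (TensorProduct.map LinearMap.id (TensorProduct.map LinearMap.id LinearMap.id)
        ((E.frame x₀ z.1 z.2.1.1).tensorProduct ((F.frame x₀ z.1 z.2.1.2.1).tensorProduct
          (G.frame x₀ z.1 z.2.1.2.2)) (j, k, l))) (j', k', l') =
    (((E.frame x₁ z.1 z.2.2.1.1).tensorProduct (F.frame x₁ z.1 z.2.2.1.2)).tensorProduct
      (G.frame x₁ z.1 z.2.2.2)).repr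
      ((TensorProduct.assoc ℂ _ _ _).symm
        ((E.frame x₀ z.1 z.2.1.1).tensorProduct ((F.frame x₀ z.1 z.2.1.2.1).tensorProduct
          (G.frame x₀ z.1 z.2.1.2.2)) (j, k, l))) ((j', k'), l')
  simp [mul_assoc]

end IsContFam

/-! ### Equivariant vector bundles -/

/-- A `T`-equivariant complex vector bundle over a `T`-space `X`: a vector bundle on whose total
space `T` acts continuously, covering the action on `X` and linearly on the fibres. The map
`act t h : E_x → E_y` is the action of `t`, where `h` witnesses that `t • x = y`. -/
structure TBundle (T : Type v) (X : Type u) [Group T] [TopologicalSpace T] [TopologicalSpace X]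
    [MulAction T X] extends VBundle X where
  act : ∀ (t : T) {x y : X}, t • x = y → (fib x →ₗ[ℂ] fib y)
  act_one : ∀ (x : X) (h : (1 : T) • x = x) (v : fib x), act 1 h v = v
  act_mul : ∀ (s t : T) (x y z : X) (h₁ : t • x = y) (h₂ : s • y = z) (h₃ : (s * t) • x = z)
    (v : fib x), act (s * t) h₃ v = act s h₂ (act t h₁ v)
  continuous_act : IsContFam toVBundle toVBundle (fun p : T × X => p.2) (fun p => p.1 • p.2)
    (fun p => act p.1 rfl)

namespace TBundle

variable {T : Type v} {X : Type u} {Y : Type w} [Group T] [TopologicalSpace T]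
  [TopologicalSpace X] [TopologicalSpace Y] [MulAction T X] [MulAction T Y]

/-- The zero bundle. -/
def zero (T : Type v) (X : Type u) [Group T] [TopologicalSpace T] [TopologicalSpace X]
    [MulAction T X] : TBundle T X where
  toVBundle := VBundle.zero X
  act _ _ _ _ := LinearMap.id (M := PUnit)
  act_one _ _ _ := rfl
  act_mul _ _ _ _ _ _ _ _ _ := rfl
  continuous_act _ _ j := Empty.elim j

/-- The product line bundle with `T` acting trivially on the fibre `ℂ`. -/
def one (T : Type v) (X : Type u) [Group T] [TopologicalSpace T] [TopologicalSpace X]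
    [MulAction T X] : TBundle T X where
  toVBundle := VBundle.one X
  act _ _ _ _ := LinearMap.id (M := ℂ)
  act_one _ _ _ := rfl
  act_mul _ _ _ _ _ _ _ _ _ := rfl
  continuous_act x₀ x₁ j i := (continuous_const : Continuous
    fun _ : {z : T × X // z.2 ∈ (VBundle.one X).nhd x₀ ∧ z.1 • z.2 ∈ (VBundle.one X).nhd x₁} =>
      (Basis.singleton Unit ℂ).repr (Basis.singleton Unit ℂ j) i)

/-- The direct sum, with the diagonal action. -/
def sum (E F : TBundle T X) : TBundle T X where
  toVBundle := E.toVBundle.sum F.toVBundle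
  act t _ _ h := (E.act t h).prodMap (F.act t h)
  act_one x h v := Prod.ext (E.act_one x h v.1) (F.act_one x h v.2)
  act_mul s t x y z h₁ h₂ h₃ v :=
    Prod.ext (E.act_mul s t x y z h₁ h₂ h₃ v.1) (F.act_mul s t x y z h₁ h₂ h₃ v.2)
  continuous_act := E.continuous_act.prodMap F.continuous_act

/-- The tensor product, with the diagonal action. -/
def tensor (E F : TBundle T X) : TBundle T X where
  toVBundle := E.toVBundle.tensor F.toVBundle
  act t _ _ h := TensorProduct.map (E.act t h) (F.act t h)
  act_one x h v := by
    have h₁ : E.act 1 h = LinearMap.id := LinearMap.ext (E.act_one x h)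
    have h₂ : F.act 1 h = LinearMap.id := LinearMap.ext (F.act_one x h)
    rw [h₁, h₂, TensorProduct.map_id]
    rfl
  act_mul s t x y z h₁ h₂ h₃ v := by
    have e₁ : E.act (s * t) h₃ = E.act s h₂ ∘ₗ E.act t h₁ :=
      LinearMap.ext (E.act_mul s t x y z h₁ h₂ h₃)
    have e₂ : F.act (s * t) h₃ = F.act s h₂ ∘ₗ F.act t h₁ :=
      LinearMap.ext (F.act_mul s t x y z h₁ h₂ h₃)
    rw [e₁, e₂, TensorProduct.map_comp]
    rfl
  continuous_act := by
    have h := E.continuous_act.tensorMap F.continuous_act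
    exact h

/-- The dual bundle, with the contragredient action `(t f)(v) = f (t⁻¹ v)`. -/
def dual [ContinuousInv T] [ContinuousSMul T X] (E : TBundle T X) : TBundle T X where
  toVBundle := E.toVBundle.dual
  act t _ _ h := (E.act t⁻¹ (inv_smul_eq_iff.2 h.symm)).dualMap
  act_one x h f := by
    change Module.Dual ℂ (E.fib x) at f
    refine LinearMap.ext fun v => congrArg (fun u => f u) ?_
    have : ∀ (s : T) (hs : s = 1) (h' : s • x = x), E.act s h' v = v := by
      rintro s rfl h'
      exact E.act_one x h' v
    exact this _ inv_one _
  act_mul s t x y z h₁ h₂ h₃ f := by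
    change Module.Dual ℂ (E.fib x) at f
    refine LinearMap.ext fun v => congrArg (fun u => f u) ?_
    have : ∀ (r : T) (hr : r = t⁻¹ * s⁻¹) (h' : r • z = x), E.act r h' v =
        E.act t⁻¹ (inv_smul_eq_iff.2 h₁.symm) (E.act s⁻¹ (inv_smul_eq_iff.2 h₂.symm) v) := by
      rintro r rfl h'
      exact E.act_mul _ _ _ _ _ _ _ _ _
    exact this _ (mul_inv_rev s t) _
  continuous_act := by
    have h := E.continuous_act.param (g := fun p : T × X => (p.1⁻¹, p.1 • p.2)) (by fun_prop)
    refine IsContFam.dualMap (a := fun p : T × X => p.1 • p.2) (b := fun p => p.2)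
      (φ := fun p => E.act p.1⁻¹ (inv_smul_smul p.1 p.2)) ?_
    have key : ∀ (b : T × X → X) (hb : ∀ p, p.1⁻¹ • p.1 • p.2 = b p),
        IsContFam E.toVBundle E.toVBundle (fun p : T × X => p.1 • p.2) b
          (fun p => E.act p.1⁻¹ (hb p)) := by
      intro b hb
      obtain rfl : b = fun p => p.1⁻¹ • p.1 • p.2 := funext fun p => (hb p).symm
      exact h
    exact key _ _

/-- The exterior powers. -/
def ext (E : TBundle T X) (n : ℕ) : TBundle T X where
  toVBundle := E.toVBundle.ext n
  act t _ _ h := exteriorPower.map n (E.act t h)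
  act_one x h v := by
    have h₁ : E.act 1 h = LinearMap.id := LinearMap.ext (E.act_one x h)
    rw [h₁, exteriorPower.map_id]
    rfl
  act_mul s t x y z h₁ h₂ h₃ v := by
    have e₁ : E.act (s * t) h₃ = E.act s h₂ ∘ₗ E.act t h₁ :=
      LinearMap.ext (E.act_mul s t x y z h₁ h₂ h₃)
    rw [e₁]
    exact LinearMap.congr_fun (exteriorPower.map_comp (n := n) (E.act t h₁) (E.act s h₂)) v
  continuous_act := E.continuous_act.extMap n

/-- The pullback along a continuous equivariant map. -/
def pullback (E : TBundle T X) (f : Y → X) (hf : Continuous f)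
    (hf' : ∀ (t : T) y, f (t • y) = t • f y) : TBundle T Y where
  toVBundle := E.toVBundle.pullback f hf
  act t _ _ h := E.act t ((hf' t _).symm.trans (congrArg f h))
  act_one _ _ v := E.act_one _ _ v
  act_mul s t _ _ _ _ _ _ v := E.act_mul s t _ _ _ _ _ _ v
  continuous_act := by
    have h := E.continuous_act.param (g := fun p : T × Y => (p.1, f p.2)) (by fun_prop)
    have key : ∀ (b : T × Y → X) (hb : ∀ p, p.1 • f p.2 = b p),
        IsContFam E.toVBundle E.toVBundle (fun p : T × Y => f p.2) b
          (fun p => E.act p.1 (hb p)) := by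
      intro b hb
      obtain rfl : b = fun p => p.1 • f p.2 := funext fun p => (hb p).symm
      exact h
    exact fun y₀ y₁ j i => key (fun p => f (p.1 • p.2)) (fun p => (hf' p.1 p.2).symm)
      (f y₀) (f y₁) j i

/-- An isomorphism of `T`-equivariant vector bundles over `X`. -/
structure Iso (E F : TBundle T X) where
  toEquiv : ∀ x, E.fib x ≃ₗ[ℂ] F.fib x
  equivariant : ∀ (t : T) (x y : X) (h : t • x = y) (v : E.fib x),
    toEquiv y (E.act t h v) = F.act t h (toEquiv x v)
  continuous_toEquiv : IsContFam E.toVBundle F.toVBundle id id (fun x => (toEquiv x).toLinearMap)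
  continuous_symm :
    IsContFam F.toVBundle E.toVBundle id id (fun x => (toEquiv x).symm.toLinearMap)

namespace Iso

variable {E F G H : TBundle T X}

def refl (E : TBundle T X) : Iso E E where
  toEquiv _ := LinearEquiv.refl _ _
  equivariant _ _ _ _ _ := rfl
  continuous_toEquiv := isContFam_id _
  continuous_symm := isContFam_id _

def symm (e : Iso E F) : Iso F E where
  toEquiv x := (e.toEquiv x).symm
  equivariant t x y h v := by
    rw [LinearEquiv.symm_apply_eq, e.equivariant, LinearEquiv.apply_symm_apply]
  continuous_toEquiv := e.continuous_symm
  continuous_symm := e.continuous_toEquiv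

def trans (e : Iso E F) (f : Iso F G) : Iso E G where
  toEquiv x := (e.toEquiv x).trans (f.toEquiv x)
  equivariant t x y h v := by simp [e.equivariant, f.equivariant]
  continuous_toEquiv := by
    have h := f.continuous_toEquiv.comp e.continuous_toEquiv continuous_id
    exact h
  continuous_symm := by
    have h := e.continuous_symm.comp f.continuous_symm continuous_id
    exact h

def sumCongr (e : Iso E F) (f : Iso G H) : Iso (E.sum G) (F.sum H) where
  toEquiv x := (e.toEquiv x).prodCongr (f.toEquiv x)
  equivariant t x y h v := Prod.ext (e.equivariant t x y h v.1) (f.equivariant t x y h v.2)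
  continuous_toEquiv := by
    have h := e.continuous_toEquiv.prodMap f.continuous_toEquiv
    exact h
  continuous_symm := by
    have h := e.continuous_symm.prodMap f.continuous_symm
    exact h

def tensorCongr (e : Iso E F) (f : Iso G H) : Iso (E.tensor G) (F.tensor H) where
  toEquiv x := TensorProduct.congr (e.toEquiv x) (f.toEquiv x)
  equivariant t x y h v := by
    have key : (TensorProduct.congr (e.toEquiv y) (f.toEquiv y)).toLinearMap ∘ₗ
        TensorProduct.map (E.act t h) (G.act t h) =
        TensorProduct.map (F.act t h) (H.act t h) ∘ₗ
          (TensorProduct.congr (e.toEquiv x) (f.toEquiv x)).toLinearMap :=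
      TensorProduct.ext' fun a b => congrArg₂ (TensorProduct.tmul ℂ) (e.equivariant t x y h a)
        (f.equivariant t x y h b)
    exact LinearMap.congr_fun key v
  continuous_toEquiv := by
    have h := e.continuous_toEquiv.tensorMap f.continuous_toEquiv
    exact h
  continuous_symm := by
    have h := e.continuous_symm.tensorMap f.continuous_symm
    exact h

def sumComm (E F : TBundle T X) : Iso (E.sum F) (F.sum E) where
  toEquiv x := LinearEquiv.prodComm ℂ (E.fib x) (F.fib x)
  equivariant _ _ _ _ _ := rfl
  continuous_toEquiv := by
    have h := (IsContFam.snd E.toVBundle F.toVBundle).pair (IsContFam.fst E.toVBundle F.toVBundle)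
    exact h
  continuous_symm := by
    have h := (IsContFam.snd F.toVBundle E.toVBundle).pair (IsContFam.fst F.toVBundle E.toVBundle)
    exact h

def sumAssoc (E F G : TBundle T X) : Iso ((E.sum F).sum G) (E.sum (F.sum G)) where
  toEquiv x := LinearEquiv.prodAssoc ℂ (E.fib x) (F.fib x) (G.fib x)
  equivariant _ _ _ _ _ := rfl
  continuous_toEquiv := by
    have h₁ := IsContFam.fst (E.toVBundle.sum F.toVBundle) G.toVBundle
    have h₂ := IsContFam.snd (E.toVBundle.sum F.toVBundle) G.toVBundle
    have h₃ := (IsContFam.fst E.toVBundle F.toVBundle).comp h₁ continuous_id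
    have h₄ := (IsContFam.snd E.toVBundle F.toVBundle).comp h₁ continuous_id
    have h₅ := h₃.pair (h₄.pair h₂)
    refine IsContFam.congr (a := id) (b := id) h₅ fun x => ?_
    have key : (LinearMap.fst ℂ (E.fib x) (F.fib x) ∘ₗ LinearMap.fst ℂ _ (G.fib x)).prod
        ((LinearMap.snd ℂ (E.fib x) (F.fib x) ∘ₗ LinearMap.fst ℂ _ (G.fib x)).prod
          (LinearMap.snd ℂ _ _)) =
        (LinearEquiv.prodAssoc ℂ (E.fib x) (F.fib x) (G.fib x)).toLinearMap := rfl
    exact key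
  continuous_symm := by
    have h₁ := IsContFam.fst E.toVBundle (F.toVBundle.sum G.toVBundle)
    have h₂ := IsContFam.snd E.toVBundle (F.toVBundle.sum G.toVBundle)
    have h₃ := (IsContFam.fst F.toVBundle G.toVBundle).comp h₂ continuous_id
    have h₄ := (IsContFam.snd F.toVBundle G.toVBundle).comp h₂ continuous_id
    have h₅ := (h₁.pair h₃).pair h₄
    refine IsContFam.congr (a := id) (b := id) h₅ fun x => ?_
    have key : ((LinearMap.fst ℂ (E.fib x) (F.fib x × G.fib x)).prod
        (LinearMap.fst ℂ (F.fib x) (G.fib x) ∘ₗ LinearMap.snd ℂ _ _)).prod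
        (LinearMap.snd ℂ (F.fib x) (G.fib x) ∘ₗ LinearMap.snd ℂ _ _) =
        (LinearEquiv.prodAssoc ℂ (E.fib x) (F.fib x) (G.fib x)).symm.toLinearMap := rfl
    exact key

def zeroSum (E : TBundle T X) : Iso ((zero T X).sum E) E where
  toEquiv _ :=
    { toFun := fun v => v.2
      invFun := fun v => (PUnit.unit, v)
      map_add' := fun _ _ => rfl
      map_smul' := fun _ _ => rfl
      left_inv := fun _ => rfl
      right_inv := fun _ => rfl }
  equivariant _ _ _ _ _ := rfl
  continuous_toEquiv := by
    have h := IsContFam.snd (zero T X).toVBundle E.toVBundle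
    exact h
  continuous_symm := by
    have h := IsContFam.inr (zero T X).toVBundle E.toVBundle
    exact h

def zeroTensor (E : TBundle T X) : Iso ((zero T X).tensor E) (zero T X) where
  toEquiv x :=
    { toFun := fun _ => PUnit.unit
      invFun := fun _ => (0 : PUnit ⊗[ℂ] E.fib x)
      map_add' := fun _ _ => rfl
      map_smul' := fun _ _ => rfl
      left_inv := fun _ => Subsingleton.elim (α := PUnit ⊗[ℂ] E.fib x) _ _
      right_inv := fun _ => rfl }
  equivariant _ _ _ _ _ := rfl
  continuous_toEquiv _ _ j := Empty.elim j.1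
  continuous_symm _ _ j := Empty.elim j

def tensorSum (E F G : TBundle T X) :
    Iso (E.tensor (F.sum G)) ((E.tensor F).sum (E.tensor G)) where
  toEquiv x := TensorProduct.prodRight ℂ ℂ (E.fib x) (F.fib x) (G.fib x)
  equivariant t x y h v := by
    have key : (TensorProduct.prodRight ℂ ℂ (E.fib y) (F.fib y) (G.fib y)).toLinearMap ∘ₗ
        TensorProduct.map (E.act t h) ((F.act t h).prodMap (G.act t h)) =
        (TensorProduct.map (E.act t h) (F.act t h)).prodMap
          (TensorProduct.map (E.act t h) (G.act t h)) ∘ₗ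
          (TensorProduct.prodRight ℂ ℂ (E.fib x) (F.fib x) (G.fib x)).toLinearMap :=
      TensorProduct.ext' fun _ _ => rfl
    exact LinearMap.congr_fun key v
  continuous_toEquiv := by
    have h₁ := (isContFam_id E.toVBundle).tensorMap (IsContFam.fst F.toVBundle G.toVBundle)
    have h₂ := (isContFam_id E.toVBundle).tensorMap (IsContFam.snd F.toVBundle G.toVBundle)
    refine IsContFam.congr (a := id) (b := id) (h₁.pair h₂) fun x => ?_
    have key : (TensorProduct.map LinearMap.id (LinearMap.fst ℂ (F.fib x) (G.fib x))).prod
        (TensorProduct.map LinearMap.id (LinearMap.snd ℂ (F.fib x) (G.fib x))) =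
        (TensorProduct.prodRight ℂ ℂ (E.fib x) (F.fib x) (G.fib x)).toLinearMap :=
      TensorProduct.ext' fun _ _ => rfl
    exact key
  continuous_symm := by
    have h₁ := (isContFam_id E.toVBundle).tensorMap (IsContFam.inl F.toVBundle G.toVBundle)
    have h₂ := (isContFam_id E.toVBundle).tensorMap (IsContFam.inr F.toVBundle G.toVBundle)
    refine IsContFam.congr (a := id) (b := id) (h₁.coprod h₂) fun x => ?_
    have key : (TensorProduct.map LinearMap.id (LinearMap.inl ℂ (F.fib x) (G.fib x))).coprod
        (TensorProduct.map LinearMap.id (LinearMap.inr ℂ (F.fib x) (G.fib x))) =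
        (TensorProduct.prodRight ℂ ℂ (E.fib x) (F.fib x) (G.fib x)).symm.toLinearMap := by
      refine LinearMap.prod_ext ?_ ?_ <;>
        exact TensorProduct.ext' fun a b => by simp [LinearEquiv.eq_symm_apply]
    exact key

def tensorComm (E F : TBundle T X) : Iso (E.tensor F) (F.tensor E) where
  toEquiv x := TensorProduct.comm ℂ (E.fib x) (F.fib x)
  equivariant t x y h v := by
    have key : (TensorProduct.comm ℂ (E.fib y) (F.fib y)).toLinearMap ∘ₗ
        TensorProduct.map (E.act t h) (F.act t h) = TensorProduct.map (F.act t h) (E.act t h) ∘ₗ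
          (TensorProduct.comm ℂ (E.fib x) (F.fib x)).toLinearMap :=
      TensorProduct.ext' fun _ _ => rfl
    exact LinearMap.congr_fun key v
  continuous_toEquiv := IsContFam.tensorComm _ _
  continuous_symm := IsContFam.tensorComm _ _

def oneTensor (E : TBundle T X) : Iso ((one T X).tensor E) E where
  toEquiv x := TensorProduct.lid ℂ (E.fib x)
  equivariant t x y h v := by
    have key : (TensorProduct.lid ℂ (E.fib y)).toLinearMap ∘ₗ
        TensorProduct.map LinearMap.id (E.act t h) =
        E.act t h ∘ₗ (TensorProduct.lid ℂ (E.fib x)).toLinearMap :=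
      TensorProduct.ext' fun a b => by simp
    exact LinearMap.congr_fun key v
  continuous_toEquiv := IsContFam.lid _
  continuous_symm := IsContFam.lid_symm _

def tensorAssoc (E F G : TBundle T X) :
    Iso ((E.tensor F).tensor G) (E.tensor (F.tensor G)) where
  toEquiv x := TensorProduct.assoc ℂ (E.fib x) (F.fib x) (G.fib x)
  equivariant t x y h v := by
    have key : (TensorProduct.assoc ℂ (E.fib y) (F.fib y) (G.fib y)).toLinearMap ∘ₗ
        TensorProduct.map (TensorProduct.map (E.act t h) (F.act t h)) (G.act t h) =
        TensorProduct.map (E.act t h) (TensorProduct.map (F.act t h) (G.act t h)) ∘ₗ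
          (TensorProduct.assoc ℂ (E.fib x) (F.fib x) (G.fib x)).toLinearMap :=
      TensorProduct.ext_threefold fun _ _ _ => rfl
    exact LinearMap.congr_fun key v
  continuous_toEquiv := IsContFam.assoc _ _ _
  continuous_symm := IsContFam.assoc_symm _ _ _

end Iso

end TBundle

/-! ### The Grothendieck ring of a commutative semiring -/

section Grothendieck

open Algebra

variable {S : Type u} [CommSemiring S]

theorem GrothendieckAddGroup.lift_of {M A : Type*} [AddCommMonoid M] [AddCommGroup A] (f : M →+ A)
    (a : M) : GrothendieckAddGroup.lift f (GrothendieckAddGroup.of a) = f a :=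
  DFunLike.congr_fun (GrothendieckAddGroup.lift.symm_apply_apply f) a

theorem GrothendieckAddGroup.exists_sub {M : Type*} [AddCommMonoid M]
    (x : GrothendieckAddGroup M) :
    ∃ a b : M, x = GrothendieckAddGroup.of a - GrothendieckAddGroup.of b := by
  induction x using AddLocalization.ind with
  | H y =>
    obtain ⟨a, b⟩ := y
    refine ⟨a, b, ?_⟩
    rw [eq_sub_iff_add_eq]
    change AddLocalization.mk a b + (AddLocalization.addMonoidOf ⊤) b.1 =
      (AddLocalization.addMonoidOf ⊤) a
    rw [← AddLocalization.mk_zero_eq_addMonoidOf_mk, ← AddLocalization.mk_zero_eq_addMonoidOf_mk,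
      AddLocalization.mk_add, AddLocalization.mk_eq_mk_iff, AddLocalization.r_iff_exists]
    exact ⟨0, by simp [add_comm]⟩

/-- The multiplication of the Grothendieck ring, determined by `[a] [b] = [a b]`. -/
def groMul (S : Type u) [CommSemiring S] :
    GrothendieckAddGroup S →+ GrothendieckAddGroup S →+ GrothendieckAddGroup S :=
  GrothendieckAddGroup.lift
    { toFun := fun a => GrothendieckAddGroup.lift
        ((GrothendieckAddGroup.of (M := S)).comp (AddMonoidHom.mulLeft a))
      map_zero' := GrothendieckAddGroup.lift.symm.injective (by ext; simp)
      map_add' := fun a b => GrothendieckAddGroup.lift.symm.injective (by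
        ext c
        have h := fun a : S => GrothendieckAddGroup.lift_of
          ((GrothendieckAddGroup.of (M := S)).comp (AddMonoidHom.mulLeft a)) c
        refine (h (a + b)).trans (Eq.trans ?_ (congrArg₂ (· + ·) (h a) (h b)).symm)
        simp [add_mul]) }

theorem groMul_of (a b : S) : groMul S (GrothendieckAddGroup.of a) (GrothendieckAddGroup.of b) =
    GrothendieckAddGroup.of (a * b) := by
  rw [groMul, GrothendieckAddGroup.lift_of]
  exact GrothendieckAddGroup.lift_of _ b

/-- The ring completion of a commutative semiring, on Mathlib's Grothendieck group of its additive
monoid. -/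
abbrev groRing (S : Type u) [CommSemiring S] : CommRing (GrothendieckAddGroup S) :=
  { (inferInstance : AddCommGroup (GrothendieckAddGroup S)) with
    mul := fun x y => groMul S x y
    one := GrothendieckAddGroup.of 1
    left_distrib := fun x y z => map_add (groMul S x) y z
    right_distrib := fun x y z => by
      change groMul S (x + y) z = groMul S x z + groMul S y z
      rw [map_add, AddMonoidHom.add_apply]
    zero_mul := fun x => by
      change groMul S 0 x = 0
      rw [map_zero, AddMonoidHom.zero_apply]
    mul_zero := fun x => map_zero (groMul S x)
    mul_comm := fun x y => by
      change groMul S x y = groMul S y x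
      obtain ⟨a, b, rfl⟩ := GrothendieckAddGroup.exists_sub x
      obtain ⟨c, d, rfl⟩ := GrothendieckAddGroup.exists_sub y
      simp only [map_sub, AddMonoidHom.sub_apply, groMul_of, mul_comm]
      abel
    mul_assoc := fun x y z => by
      change groMul S (groMul S x y) z = groMul S x (groMul S y z)
      obtain ⟨a, b, rfl⟩ := GrothendieckAddGroup.exists_sub x
      obtain ⟨c, d, rfl⟩ := GrothendieckAddGroup.exists_sub y
      obtain ⟨e, f, rfl⟩ := GrothendieckAddGroup.exists_sub z
      simp only [map_sub, AddMonoidHom.sub_apply, groMul_of, mul_assoc]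
    one_mul := fun x => by
      change groMul S (GrothendieckAddGroup.of 1) x = x
      obtain ⟨a, b, rfl⟩ := GrothendieckAddGroup.exists_sub x
      simp only [map_sub, groMul_of, one_mul]
    mul_one := fun x => by
      change groMul S x (GrothendieckAddGroup.of 1) = x
      obtain ⟨a, b, rfl⟩ := GrothendieckAddGroup.exists_sub x
      simp only [map_sub, AddMonoidHom.sub_apply, groMul_of, mul_one] }

end Grothendieck

/-! ### Equivariant K-theory -/

section KTheory

variable (T : Type v) (X : Type u) [Group T] [TopologicalSpace T] [TopologicalSpace X]
  [MulAction T X]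

instance TBundle.setoid : Setoid (TBundle T X) where
  r E F := Nonempty (TBundle.Iso E F)
  iseqv := ⟨fun E => ⟨TBundle.Iso.refl E⟩, fun ⟨e⟩ => ⟨e.symm⟩, fun ⟨e⟩ ⟨f⟩ => ⟨e.trans f⟩⟩

/-- Isomorphism classes of `T`-equivariant complex vector bundles over `X`. -/
def Vect : Type (max u v 1) := Quotient (TBundle.setoid T X)

instance Vect.instZero : Zero (Vect T X) := ⟨Quotient.mk _ (TBundle.zero T X)⟩

instance Vect.instAdd : Add (Vect T X) :=
  ⟨Quotient.map₂ TBundle.sum fun _ _ ⟨e⟩ _ _ ⟨f⟩ => ⟨e.sumCongr f⟩⟩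

/-- The semiring structure on isomorphism classes given by `⊕` and `⊗`. -/
instance Vect.instCommSemiring : CommSemiring (Vect T X) where
  mul := Quotient.map₂ TBundle.tensor fun _ _ ⟨e⟩ _ _ ⟨f⟩ => ⟨e.tensorCongr f⟩
  one := Quotient.mk _ (TBundle.one T X)
  nsmul := nsmulRec
  add_comm := by
    rintro ⟨E⟩ ⟨F⟩
    exact Quotient.sound ⟨TBundle.Iso.sumComm E F⟩
  add_assoc := by
    rintro ⟨E⟩ ⟨F⟩ ⟨G⟩
    exact Quotient.sound ⟨TBundle.Iso.sumAssoc E F G⟩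
  zero_add := by
    rintro ⟨E⟩
    exact Quotient.sound ⟨TBundle.Iso.zeroSum E⟩
  add_zero := by
    rintro ⟨E⟩
    exact Quotient.sound ⟨(TBundle.Iso.sumComm _ _).trans (TBundle.Iso.zeroSum E)⟩
  mul_comm := by
    rintro ⟨E⟩ ⟨F⟩
    exact Quotient.sound ⟨TBundle.Iso.tensorComm E F⟩
  mul_assoc := by
    rintro ⟨E⟩ ⟨F⟩ ⟨G⟩
    exact Quotient.sound ⟨TBundle.Iso.tensorAssoc E F G⟩
  one_mul := by
    rintro ⟨E⟩
    exact Quotient.sound ⟨TBundle.Iso.oneTensor E⟩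
  mul_one := by
    rintro ⟨E⟩
    exact Quotient.sound ⟨(TBundle.Iso.tensorComm _ _).trans (TBundle.Iso.oneTensor E)⟩
  zero_mul := by
    rintro ⟨E⟩
    exact Quotient.sound ⟨TBundle.Iso.zeroTensor E⟩
  mul_zero := by
    rintro ⟨E⟩
    exact Quotient.sound ⟨(TBundle.Iso.tensorComm _ _).trans (TBundle.Iso.zeroTensor E)⟩
  left_distrib := by
    rintro ⟨E⟩ ⟨F⟩ ⟨G⟩
    exact Quotient.sound ⟨TBundle.Iso.tensorSum E F G⟩
  right_distrib := by
    rintro ⟨E⟩ ⟨F⟩ ⟨G⟩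
    exact Quotient.sound ⟨((TBundle.Iso.tensorComm _ _).trans (TBundle.Iso.tensorSum G E F)).trans
      ((TBundle.Iso.tensorComm _ _).sumCongr (TBundle.Iso.tensorComm _ _))⟩

/-- The equivariant K-theory ring `K_T(X)`: the Grothendieck ring of `T`-equivariant complex
vector bundles over `X`. -/
def KT : Type (max u v 1) := Algebra.GrothendieckAddGroup (Vect T X)

instance KT.instCommRing : CommRing (KT T X) := groRing (Vect T X)

variable {T X}

/-- The class `[E]` in `K_T(X)`. -/
def KT.of (E : TBundle T X) : KT T X :=
  Algebra.GrothendieckAddGroup.of (M := Vect T X) (Quotient.mk _ E)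

/-- The K-theoretic Euler class `λ₋₁(E*) = ∑ₖ (-1)ᵏ [Λᵏ E*]`. -/
def KT.euler [ContinuousInv T] [ContinuousSMul T X] (E : TBundle T X) : KT T X :=
  ∑ᶠ k : ℕ, (-1) ^ k * KT.of (E.dual.ext k)

variable {Y : Type w} [TopologicalSpace Y] [MulAction T Y]

def TBundle.Iso.pullbackCongr {E F : TBundle T X} (e : TBundle.Iso E F) (f : Y → X)
    (hf : Continuous f) (hf' : ∀ (t : T) y, f (t • y) = t • f y) :
    TBundle.Iso (E.pullback f hf hf') (F.pullback f hf hf') where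
  toEquiv y := e.toEquiv (f y)
  equivariant t _ _ _ v := e.equivariant t _ _ _ v
  continuous_toEquiv y₀ y₁ j i := e.continuous_toEquiv.param hf (f y₀) (f y₁) j i
  continuous_symm y₀ y₁ j i := e.continuous_symm.param hf (f y₀) (f y₁) j i

/-- Pullback of isomorphism classes of equivariant bundles. -/
def Vect.pullback (f : Y → X) (hf : Continuous f) (hf' : ∀ (t : T) y, f (t • y) = t • f y) :
    Vect T X →+* Vect T Y where
  toFun := Quotient.map (fun E => E.pullback f hf hf') fun _ _ ⟨e⟩ => ⟨e.pullbackCongr f hf hf'⟩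
  map_zero' := rfl
  map_one' := rfl
  map_add' := by
    rintro ⟨E⟩ ⟨F⟩
    rfl
  map_mul' := by
    rintro ⟨E⟩ ⟨F⟩
    rfl

/-- Pullback `f^* : K_T(X) → K_T(Y)` along a continuous equivariant map `f : Y → X`. -/
def KT.pullback (f : Y → X) (hf : Continuous f) (hf' : ∀ (t : T) y, f (t • y) = t • f y) :
    KT T X →+* KT T Y :=
  let φ : Algebra.GrothendieckAddGroup (Vect T X) →+ Algebra.GrothendieckAddGroup (Vect T Y) :=
    Algebra.GrothendieckAddGroup.lift
      (Algebra.GrothendieckAddGroup.of.comp (Vect.pullback f hf hf').toAddMonoidHom)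
  have hφ : ∀ a, φ (Algebra.GrothendieckAddGroup.of a) =
      Algebra.GrothendieckAddGroup.of (Vect.pullback f hf hf' a) :=
    fun a => GrothendieckAddGroup.lift_of _ a
  { toFun := φ
    map_zero' := map_zero φ
    map_add' := map_add φ
    map_one' := (hφ 1).trans (congrArg _ (map_one (Vect.pullback f hf hf')))
    map_mul' := fun x y => by
      change φ (groMul _ x y) = groMul _ (φ x) (φ y)
      obtain ⟨a, b, rfl⟩ := GrothendieckAddGroup.exists_sub x
      obtain ⟨c, d, rfl⟩ := GrothendieckAddGroup.exists_sub y
      simp only [map_sub, AddMonoidHom.sub_apply, groMul_of, hφ, map_mul] }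

/-- `K_T(X)` is an algebra over `K_T(pt)` through the map `X → pt`. -/
instance KT.instAlgebra : Algebra (KT T PUnit.{1}) (KT T X) :=
  (KT.pullback (fun _ : X => PUnit.unit) continuous_const (fun _ _ => rfl)).toAlgebra

end KTheory

/-! ### Retracts of vector bundles -/

/-- A family of vector spaces `Q x` that is fibrewise a retract of a vector bundle `E`, such that
the resulting idempotents of the fibres of `E` are continuous. -/
structure Retract {X : Type u} [TopologicalSpace X] (E : VBundle X) where
  Q : X → Type
  [instAddCommGroup : ∀ x, AddCommGroup (Q x)]
  [instModule : ∀ x, Module ℂ (Q x)]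
  i : ∀ x, Q x →ₗ[ℂ] E.fib x
  r : ∀ x, E.fib x →ₗ[ℂ] Q x
  r_i : ∀ x v, r x (i x v) = v
  continuous_i_r : IsContFam E E id id (fun x => i x ∘ₗ r x)

attribute [instance] Retract.instAddCommGroup Retract.instModule

namespace Retract

open scoped Matrix Classical

variable {X : Type u} [TopologicalSpace X] {E : VBundle X} (D : Retract E)

instance (x : X) : Fintype (E.idx x) := Fintype.ofFinite _

/-- The matrix of the idempotent in the frame around `x₀`. -/
def mat (x₀ : X) (x : E.nhd x₀) : Matrix (E.idx x₀) (E.idx x₀) ℂ :=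
  fun k l => (E.frame x₀ x.1 x.2).repr (D.i x.1 (D.r x.1 (E.frame x₀ x.1 x.2 l))) k

theorem continuous_mat (x₀ : X) : Continuous (D.mat x₀) :=
  continuous_matrix fun k l => (D.continuous_i_r x₀ x₀ l k).comp
    (f := fun x : E.nhd x₀ => (⟨x.1, x.2, x.2⟩ : {z : X // z ∈ E.nhd x₀ ∧ z ∈ E.nhd x₀}))
    (continuous_subtype_val.subtype_mk _)

theorem mat_mulVec (x₀ : X) (x : E.nhd x₀) (v : E.fib x.1) :
    D.mat x₀ x *ᵥ (E.frame x₀ x.1 x.2).equivFun v =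
      (E.frame x₀ x.1 x.2).equivFun (D.i x.1 (D.r x.1 v)) := by
  ext k
  rw [Basis.equivFun_apply, Basis.equivFun_apply, ← Basis.coord_apply]
  conv_rhs => rw [← (E.frame x₀ x.1 x.2).sum_repr v]
  simp only [map_sum, map_smul, Basis.coord_apply, mat, Matrix.mulVec, dotProduct,
    smul_eq_mul, mul_comm]

theorem mat_mul_mat (x₀ : X) (x : E.nhd x₀) : D.mat x₀ x * D.mat x₀ x = D.mat x₀ x := by
  refine Matrix.ext_of_mulVec_single fun k => ?_
  obtain ⟨v, hv⟩ := (E.frame x₀ x.1 x.2).equivFun.surjective (Pi.single k 1)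
  rw [← hv, ← Matrix.mulVec_mulVec, mat_mulVec, mat_mulVec, D.r_i]

/-- The matrix `p q + (1 - p) (1 - q)` intertwining the idempotents at `x` and at `x₀`. -/
def twist (x₀ : X) (x : E.nhd x₀) : Matrix (E.idx x₀) (E.idx x₀) ℂ :=
  D.mat x₀ x * D.mat x₀ ⟨x₀, E.mem_nhd x₀⟩ +
    (1 - D.mat x₀ x) * (1 - D.mat x₀ ⟨x₀, E.mem_nhd x₀⟩)

theorem continuous_twist (x₀ : X) : Continuous (D.twist x₀) := by
  have h := D.continuous_mat x₀
  unfold twist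
  fun_prop

theorem twist_self (x₀ : X) : D.twist x₀ ⟨x₀, E.mem_nhd x₀⟩ = 1 := by
  have h := D.mat_mul_mat x₀ ⟨x₀, E.mem_nhd x₀⟩
  simp only [twist, mul_sub, sub_mul, h, mul_one, one_mul]
  abel

/-- The points near `x₀` at which the retract is framed. -/
def nhd (x₀ : X) : Set X := {x | ∃ h : x ∈ E.nhd x₀, (D.twist x₀ ⟨x, h⟩).det ≠ 0}

theorem isOpen_nhd (x₀ : X) : IsOpen (D.nhd x₀) := by
  have h : D.nhd x₀ = Subtype.val '' {x : E.nhd x₀ | (D.twist x₀ x).det ≠ 0} := by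
    ext x
    simp [nhd]
  rw [h]
  exact (E.isOpen_nhd x₀).isOpenMap_subtype_val _
    (isOpen_ne_fun (D.continuous_twist x₀).matrix_det continuous_const)

theorem mem_nhd (x₀ : X) : x₀ ∈ D.nhd x₀ := ⟨E.mem_nhd x₀, by simp [twist_self]⟩

/-- The coordinates of `i v` in the frame of `E` around `x₀`. -/
def coords (x₀ : X) (x : E.nhd x₀) : D.Q x.1 →ₗ[ℂ] (E.idx x₀ → ℂ) :=
  (E.frame x₀ x.1 x.2).equivFun.toLinearMap ∘ₗ D.i x.1

/-- The vector of `Q x` with given coordinates. -/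
def ofCoords (x₀ : X) (x : E.nhd x₀) : (E.idx x₀ → ℂ) →ₗ[ℂ] D.Q x.1 :=
  D.r x.1 ∘ₗ (E.frame x₀ x.1 x.2).equivFun.symm.toLinearMap

theorem ofCoords_coords (x₀ : X) (x : E.nhd x₀) (v) :
    D.ofCoords x₀ x (D.coords x₀ x v) = v := by
  simp [ofCoords, coords, D.r_i]

theorem coords_ofCoords (x₀ : X) (x : E.nhd x₀) (u) :
    D.coords x₀ x (D.ofCoords x₀ x u) = D.mat x₀ x *ᵥ u := by
  obtain ⟨v, rfl⟩ := (E.frame x₀ x.1 x.2).equivFun.surjective u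
  rw [mat_mulVec]
  simp [ofCoords, coords]

theorem mat_coords (x₀ : X) (x : E.nhd x₀) (v) :
    D.mat x₀ x *ᵥ D.coords x₀ x v = D.coords x₀ x v := by
  rw [← coords_ofCoords, ofCoords_coords]

theorem ofCoords_mat (x₀ : X) (x : E.nhd x₀) (u) :
    D.ofCoords x₀ x (D.mat x₀ x *ᵥ u) = D.ofCoords x₀ x u := by
  rw [← coords_ofCoords, ofCoords_coords]

theorem mat_mul_twist (x₀ : X) (x : E.nhd x₀) :
    D.mat x₀ x * D.twist x₀ x = D.mat x₀ x * D.mat x₀ ⟨x₀, E.mem_nhd x₀⟩ := by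
  have h := D.mat_mul_mat x₀ x
  rw [twist, mul_add, ← mul_assoc, ← mul_assoc, mul_sub (D.mat x₀ x), h, mul_one, sub_self,
    zero_mul, add_zero]

theorem twist_mul_mat (x₀ : X) (x : E.nhd x₀) :
    D.twist x₀ x * D.mat x₀ ⟨x₀, E.mem_nhd x₀⟩ =
      D.mat x₀ x * D.mat x₀ ⟨x₀, E.mem_nhd x₀⟩ := by
  have h := D.mat_mul_mat x₀ ⟨x₀, E.mem_nhd x₀⟩
  rw [twist, add_mul, mul_assoc, mul_assoc, sub_mul _ _ (D.mat x₀ ⟨x₀, E.mem_nhd x₀⟩), h, one_mul,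
    sub_self, mul_zero, add_zero]

/-- The identification of `Q x₀` with `Q x` for `x` near `x₀`. -/
def fibEquiv (x₀ : X) (x : E.nhd x₀) (hx : (D.twist x₀ x).det ≠ 0) : D.Q x₀ ≃ₗ[ℂ] D.Q x.1 :=
  LinearEquiv.ofLinearMap
    (D.ofCoords x₀ x ∘ₗ D.coords x₀ ⟨x₀, E.mem_nhd x₀⟩)
    (D.ofCoords x₀ ⟨x₀, E.mem_nhd x₀⟩ ∘ₗ Matrix.mulVecLin (D.twist x₀ x)⁻¹ ∘ₗ D.coords x₀ x)
    (by
      refine LinearMap.ext fun q => ?_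
      have hu : IsUnit (D.twist x₀ x).det := isUnit_iff_ne_zero.2 hx
      simp only [LinearMap.comp_apply, Matrix.mulVecLin_apply, LinearMap.id_apply,
        D.coords_ofCoords x₀ ⟨x₀, E.mem_nhd x₀⟩]
      rw [← ofCoords_mat]
      rw [Matrix.mulVec_mulVec, ← mat_mul_twist, Matrix.mulVec_mulVec, mul_assoc,
        Matrix.mul_nonsing_inv _ hu, mul_one, mat_coords, ofCoords_coords])
    (by
      refine LinearMap.ext fun q => ?_
      have hu : IsUnit (D.twist x₀ x).det := isUnit_iff_ne_zero.2 hx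
      simp only [LinearMap.comp_apply, Matrix.mulVecLin_apply, LinearMap.id_apply,
        coords_ofCoords]
      conv_lhs => rw [← mat_coords]
      rw [Matrix.mulVec_mulVec, Matrix.mulVec_mulVec, mul_assoc, ← twist_mul_mat, ← mul_assoc,
        Matrix.nonsing_inv_mul _ hu, one_mul, mat_coords, ofCoords_coords])

instance (x : X) : Module.Finite ℂ (D.Q x) :=
  have : Module.Finite ℂ (E.fib x) := Module.Finite.of_basis (E.frame x x (E.mem_nhd x))
  Module.Finite.of_surjective (D.r x) fun v => ⟨D.i x v, D.r_i x v⟩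

/-- The local frames of the retract. -/
def frame (x₀ x : X) (hx : x ∈ D.nhd x₀) : Basis (Fin (finrank ℂ (D.Q x₀))) ℂ (D.Q x) :=
  (Module.finBasis ℂ (D.Q x₀)).map (D.fibEquiv x₀ ⟨x, hx.1⟩ hx.2)

theorem continuous_frame_repr {Z : Type*} [TopologicalSpace Z] (x₁ : X) (b : Z → X)
    (hbc : Continuous b) (hb : ∀ z, b z ∈ D.nhd x₁) (v : ∀ z, D.Q (b z))
    (hv : ∀ k, Continuous fun z => (E.frame x₁ (b z) (hb z).1).repr (D.i (b z) (v z)) k)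
    (k : Fin (finrank ℂ (D.Q x₁))) :
    Continuous fun z => (D.frame x₁ (b z) (hb z)).repr (v z) k := by
  let Λ : (E.idx x₁ → ℂ) →ₗ[ℂ] ℂ :=
    (Module.finBasis ℂ (D.Q x₁)).coord k ∘ₗ D.ofCoords x₁ ⟨x₁, E.mem_nhd x₁⟩
  have hΛ : Continuous Λ := LinearMap.continuous_of_finiteDimensional Λ
  have key : ∀ z, (D.frame x₁ (b z) (hb z)).repr (v z) k =
      Λ ((D.twist x₁ ⟨b z, (hb z).1⟩)⁻¹ *ᵥ D.coords x₁ ⟨b z, (hb z).1⟩ (v z)) := fun z => rfl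
  simp only [key]
  refine hΛ.comp ?_
  have hM : Continuous fun z => D.twist x₁ ⟨b z, (hb z).1⟩ :=
    (D.continuous_twist x₁).comp (hbc.subtype_mk fun z => (hb z).1)
  have hMi : Continuous fun z => (D.twist x₁ ⟨b z, (hb z).1⟩)⁻¹ := by
    simp only [Matrix.inv_def, Ring.inverse_eq_inv']
    exact (hM.matrix_det.inv₀ fun z => (hb z).2).smul hM.matrix_adjugate
  exact hMi.matrix_mulVec (continuous_pi fun l => hv l)

theorem continuous_i_frame (x₀ x₁ : X) (j) (k) :
    Continuous fun z : {z : X // z ∈ D.nhd x₀ ∧ z ∈ E.nhd x₁} =>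
      (E.frame x₁ z.1 z.2.2).repr (D.i z.1 (D.frame x₀ z.1 z.2.1 j)) k := by
  let u : E.idx x₀ → ℂ := D.coords x₀ ⟨x₀, E.mem_nhd x₀⟩ (Module.finBasis ℂ (D.Q x₀) j)
  have key : ∀ z : {z : X // z ∈ D.nhd x₀ ∧ z ∈ E.nhd x₁},
      (E.frame x₁ z.1 z.2.2).repr (D.i z.1 (D.frame x₀ z.1 z.2.1 j)) k =
      ∑ l, u l * (E.frame x₁ z.1 z.2.2).repr
        (D.i z.1 (D.r z.1 (E.frame x₀ z.1 z.2.1.1 l))) k := by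
    intro z
    have h : D.frame x₀ z.1 z.2.1 j =
        D.r z.1 ((E.frame x₀ z.1 z.2.1.1).equivFun.symm u) := rfl
    rw [h, Basis.equivFun_symm_apply]
    simp [map_sum, Finsupp.finsetSum_apply]
  simp only [key]
  refine continuous_finsetSum _ fun l _ => continuous_const.mul ?_
  exact (D.continuous_i_r x₀ x₁ l k).comp
    (f := fun z : {z : X // z ∈ D.nhd x₀ ∧ z ∈ E.nhd x₁} =>
      (⟨z.1, z.2.1.1, z.2.2⟩ : {z : X // z ∈ E.nhd x₀ ∧ z ∈ E.nhd x₁}))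
    (continuous_subtype_val.subtype_mk _)

/-- A retract of a vector bundle is a vector bundle. -/
def bundle : VBundle X where
  fib := D.Q
  nhd := D.nhd
  isOpen_nhd := D.isOpen_nhd
  mem_nhd := D.mem_nhd
  idx x := Fin (finrank ℂ (D.Q x))
  frame := D.frame
  continuous_transition x₀ x₁ j i :=
    D.continuous_frame_repr x₁ (fun z : {z : X // z ∈ D.nhd x₀ ∧ z ∈ D.nhd x₁} => z.1)
      continuous_subtype_val (fun z => z.2.2) (fun z => D.frame x₀ z.1 z.2.1 j)
      (fun k => (D.continuous_i_frame x₀ x₁ j k).comp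
        (f := fun z : {z : X // z ∈ D.nhd x₀ ∧ z ∈ D.nhd x₁} =>
          (⟨z.1, z.2.1, z.2.2.1⟩ : {z : X // z ∈ D.nhd x₀ ∧ z ∈ E.nhd x₁}))
        (continuous_subtype_val.subtype_mk _)) i

theorem continuous_i : IsContFam D.bundle E id id D.i :=
  fun x₀ x₁ j k => D.continuous_i_frame x₀ x₁ j k

theorem continuous_r : IsContFam E D.bundle id id D.r := fun x₀ x₁ j k =>
  D.continuous_frame_repr x₁ (fun z : {z : X // z ∈ E.nhd x₀ ∧ z ∈ D.nhd x₁} => z.1)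
    continuous_subtype_val (fun z => z.2.2) (fun z => D.r z.1 (E.frame x₀ z.1 z.2.1 j))
    (fun k => (D.continuous_i_r x₀ x₁ j k).comp
      (f := fun z : {z : X // z ∈ E.nhd x₀ ∧ z ∈ D.nhd x₁} =>
        (⟨z.1, z.2.1, z.2.2.1⟩ : {z : X // z ∈ E.nhd x₀ ∧ z ∈ E.nhd x₁}))
      (continuous_subtype_val.subtype_mk _)) k

end Retract

/-! ### Isotypic subbundles over a space with trivial action -/

theorem continuous_integral_of_compact {T : Type v} {Z : Type w} [TopologicalSpace T]
    [TopologicalSpace Z] [CompactSpace T] [MeasurableSpace T] [BorelSpace T]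
    (m : MeasureTheory.Measure T) [MeasureTheory.IsFiniteMeasure m] (f : Z × T → ℂ)
    (hf : Continuous f) : Continuous fun z => ∫ t, f (z, t) ∂m := by
  let F : C(Z, C(T, ℂ)) := ContinuousMap.curry ⟨f, hf⟩
  have hI : Continuous fun g : C(T, ℂ) => ∫ t, g t ∂m := by
    have hint : ∀ g : C(T, ℂ), MeasureTheory.Integrable g m := fun g =>
      (MeasureTheory.integrable_const ‖g‖).mono' g.continuous.aestronglyMeasurable
        (Filter.Eventually.of_forall fun t => g.norm_coe_le_norm t)
    refine (LipschitzWith.of_dist_le_mul (K := (m.real Set.univ).toNNReal) fun g h => ?_).continuous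
    rw [dist_eq_norm, ← MeasureTheory.integral_sub (hint g) (hint h), dist_eq_norm,
      Real.coe_toNNReal _ MeasureTheory.measureReal_nonneg, mul_comm]
    exact MeasureTheory.norm_integral_le_of_norm_le_const
      (Filter.Eventually.of_forall fun t => (g - h).norm_coe_le_norm t)
  exact hI.comp F.continuous

namespace TBundle

variable {T : Type v} {X : Type u} [Group T] [TopologicalSpace T] [TopologicalSpace X]
  [MulAction T X]

theorem continuous_act_of_trivial (E : TBundle T X) (htriv : ∀ (t : T) (x : X), t • x = x) :
    IsContFam E.toVBundle E.toVBundle (fun p : T × X => p.2) (fun p => p.2)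
      (fun p => E.act p.1 (htriv p.1 p.2)) := by
  have key : ∀ (b : T × X → X) (hb : ∀ p, p.1 • p.2 = b p),
      IsContFam E.toVBundle E.toVBundle (fun p : T × X => p.2) b
        (fun p => E.act p.1 (hb p)) := by
    intro b hb
    obtain rfl : b = fun p => p.1 • p.2 := funext fun p => (hb p).symm
    exact E.continuous_act
  exact key _ _

theorem continuous_proj_smul (_E : TBundle T X) (htriv : ∀ (t : T) (x : X), t • x = x) :
    Continuous fun p : T × X => p.1 • p.2 := by
  simp only [htriv]
  exact continuous_snd

/-- The subspace of the fibre at a fixed point on which `T` acts with weight `μ`. -/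
def weightSpace (E : TBundle T X) (htriv : ∀ (t : T) (x : X), t • x = x)
    (μ : T →ₜ* Circle) (x : X) : Submodule ℂ (E.fib x) where
  carrier := {v | ∀ t : T, E.act t (htriv t x) v = (μ t : ℂ) • v}
  add_mem' {a b} ha hb t := by rw [map_add, ha t, hb t, smul_add]
  zero_mem' t := by rw [map_zero, smul_zero]
  smul_mem' c v hv t := by rw [map_smul, hv t, smul_comm]

theorem act_mem_weightSpace (E : TBundle T X) (htriv : ∀ (t : T) (x : X), t • x = x)
    (μ : T →ₜ* Circle) (t : T) {x y : X} (h : t • x = y) (v : E.fib x)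
    (hv : v ∈ E.weightSpace htriv μ x) : E.act t h v ∈ E.weightSpace htriv μ y := by
  obtain rfl : x = y := (htriv t x).symm.trans h
  rw [hv t]
  exact Submodule.smul_mem _ _ hv

/-- The subspace of the fibre on which `T` acts trivially. -/
def fixedSpace (E : TBundle T X) (htriv : ∀ (t : T) (x : X), t • x = x) (x : X) :
    Submodule ℂ (E.fib x) where
  carrier := {v | ∀ t : T, E.act t (htriv t x) v = v}
  add_mem' {a b} ha hb t := by rw [map_add, ha t, hb t]
  zero_mem' t := map_zero _
  smul_mem' c v hv t := by rw [map_smul, hv t]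

theorem weightSpace_one (E : TBundle T X) (htriv : ∀ (t : T) (x : X), t • x = x) (x : X) :
    E.weightSpace htriv 1 x = E.fixedSpace htriv x := by
  ext v
  refine forall_congr' fun t => ?_
  have : (((1 : T →ₜ* Circle) t : Circle) : ℂ) = 1 := rfl
  rw [this, one_smul]

theorem act_mem_fixedSpace (E : TBundle T X) (htriv : ∀ (t : T) (x : X), t • x = x) (t : T)
    {x y : X} (h : t • x = y) :
    E.fixedSpace htriv x ≤ (E.fixedSpace htriv y).comap (E.act t h) := by
  intro v hv
  obtain rfl : x = y := (htriv t x).symm.trans h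
  change E.act t h v ∈ E.fixedSpace htriv x
  rwa [hv t]

variable [IsTopologicalGroup T] [CompactSpace T]

/-- Averaging against a character gives a continuous family of projections onto the weight
spaces. -/
theorem exists_projection (E : TBundle T X) (htriv : ∀ (t : T) (x : X), t • x = x)
    (μ : T →ₜ* Circle) :
    ∃ P : ∀ x, E.fib x →ₗ[ℂ] E.fib x, IsContFam E.toVBundle E.toVBundle id id P ∧
      (∀ x v, P x v ∈ E.weightSpace htriv μ x) ∧
      ∀ x, ∀ v ∈ E.weightSpace htriv μ x, P x v = v := by
  classical
  let _ : MeasurableSpace T := borel T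
  have : BorelSpace T := ⟨rfl⟩
  let m : MeasureTheory.Measure T := MeasureTheory.Measure.haarMeasure ⊤
  have hm : m Set.univ = 1 := MeasureTheory.Measure.haarMeasure_self (K₀ := ⊤)
  have : MeasureTheory.IsProbabilityMeasure m := ⟨hm⟩
  let χ : T → ℂ := fun t => ((μ t)⁻¹ : Circle)
  have hχ : Continuous χ := by
    have h : Continuous fun t => (μ t)⁻¹ := μ.continuous_toFun.inv
    exact continuous_subtype_val.comp h
  have hχ' : ∀ t, χ t * (μ t : ℂ) = 1 := fun t => by
    simp [χ]
  let _ : ∀ x, Fintype (E.idx x) := fun x => Fintype.ofFinite _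
  let b : ∀ x, Basis (E.idx x) ℂ (E.fib x) := fun x => E.frame x x (E.mem_nhd x)
  have hact := E.continuous_act_of_trivial htriv
  have hcoord : ∀ x (v : E.fib x) k,
      Continuous fun t : T => (b x).repr (E.act t (htriv t x) v) k := by
    intro x v k
    have h : ∀ t, (b x).repr (E.act t (htriv t x) v) k =
        ∑ l, (b x).repr v l * (b x).repr (E.act t (htriv t x) (b x l)) k := by
      intro t
      conv_lhs => rw [← (b x).sum_repr v]
      simp only [map_sum, map_smul, Finsupp.finsetSum_apply, Finsupp.smul_apply, smul_eq_mul]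
    simp only [h]
    refine continuous_finsetSum _ fun l _ => continuous_const.mul ?_
    exact (hact x x l k).comp
      (f := fun t : T => (⟨(t, x), E.mem_nhd x, E.mem_nhd x⟩ :
        {p : T × X // p.2 ∈ E.nhd x ∧ p.2 ∈ E.nhd x})) (by fun_prop)
  have hint : ∀ f : T → ℂ, Continuous f → MeasureTheory.Integrable f m := fun f hf =>
    (MeasureTheory.integrable_const ‖(⟨f, hf⟩ : C(T, ℂ))‖).mono' hf.aestronglyMeasurable
      (Filter.Eventually.of_forall fun t => (⟨f, hf⟩ : C(T, ℂ)).norm_coe_le_norm t)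
  have hI : ∀ x v k, MeasureTheory.Integrable
      (fun t => χ t * (b x).repr (E.act t (htriv t x) v) k) m :=
    fun x v k => hint _ (hχ.mul (hcoord x v k))
  let P : ∀ x, E.fib x →ₗ[ℂ] E.fib x := fun x =>
    { toFun := fun v =>
        ∑ k, (∫ t, χ t * (b x).repr (E.act t (htriv t x) v) k ∂m) • b x k
      map_add' := fun v w => by
        rw [← Finset.sum_add_distrib]
        refine Finset.sum_congr rfl fun k _ => ?_
        rw [← add_smul, ← MeasureTheory.integral_add (hI x v k) (hI x w k)]
        simp only [map_add, Finsupp.add_apply, mul_add]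
      map_smul' := fun c v => by
        rw [RingHom.id_apply, Finset.smul_sum]
        refine Finset.sum_congr rfl fun k _ => ?_
        rw [smul_smul, ← MeasureTheory.integral_const_mul]
        simp only [map_smul, Finsupp.smul_apply, smul_eq_mul, mul_left_comm] }
  have hφ : ∀ x (φ : E.fib x →ₗ[ℂ] ℂ) v,
      φ (P x v) = ∫ t, χ t * φ (E.act t (htriv t x) v) ∂m := by
    intro x φ v
    have h : ∀ t, χ t * φ (E.act t (htriv t x) v) =
        ∑ k, (χ t * (b x).repr (E.act t (htriv t x) v) k) * φ (b x k) := by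
      intro t
      conv_lhs => rw [← (b x).sum_repr (E.act t (htriv t x) v)]
      simp only [map_sum, map_smul, smul_eq_mul, Finset.mul_sum, mul_assoc]
    simp only [h]
    rw [MeasureTheory.integral_finsetSum _ fun k _ => (hI x v k).mul_const _]
    simp only [MeasureTheory.integral_mul_const]
    change φ (∑ k, _) = _
    simp only [map_sum, map_smul, smul_eq_mul]
  have hsep : ∀ x (v w : E.fib x), (∀ φ : E.fib x →ₗ[ℂ] ℂ, φ v = φ w) → v = w := fun x v w h =>
    (b x).ext_elem fun k => h ((b x).coord k)
  refine ⟨P, ?_, ?_, ?_⟩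
  · intro x₀ x₁ j k
    have h : ∀ z : {z : X // z ∈ E.nhd x₀ ∧ z ∈ E.nhd x₁},
        (E.frame x₁ z.1 z.2.2).repr (P z.1 (E.frame x₀ z.1 z.2.1 j)) k =
        ∫ t, χ t * (E.frame x₁ z.1 z.2.2).repr
          (E.act t (htriv t z.1) (E.frame x₀ z.1 z.2.1 j)) k ∂m :=
      fun z => hφ z.1 ((E.frame x₁ z.1 z.2.2).coord k) _
    refine Continuous.congr ?_ fun z => (h z).symm
    refine continuous_integral_of_compact m
      (fun q : {z : X // z ∈ E.nhd x₀ ∧ z ∈ E.nhd x₁} × T => χ q.2 *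
        (E.frame x₁ q.1.1 q.1.2.2).repr
          (E.act q.2 (htriv q.2 q.1.1) (E.frame x₀ q.1.1 q.1.2.1 j)) k) ?_
    refine (hχ.comp continuous_snd).mul ?_
    exact (hact x₀ x₁ j k).comp
      (f := fun q : {z : X // z ∈ E.nhd x₀ ∧ z ∈ E.nhd x₁} × T =>
        (⟨(q.2, q.1.1), q.1.2.1, q.1.2.2⟩ :
          {p : T × X // p.2 ∈ E.nhd x₀ ∧ p.2 ∈ E.nhd x₁})) (by fun_prop)
  · intro x v s
    refine hsep x _ _ fun φ => ?_
    have h₁ := hφ x (φ ∘ₗ E.act s (htriv s x)) v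
    have h₂ := hφ x φ v
    simp only [LinearMap.comp_apply] at h₁
    rw [h₁, map_smul, h₂, smul_eq_mul, ← MeasureTheory.integral_const_mul,
      ← MeasureTheory.integral_mul_left_eq_self (μ := m)
        (fun t => (μ s : ℂ) * (χ t * φ (E.act t (htriv t x) v))) s]
    refine MeasureTheory.integral_congr_ae (Filter.Eventually.of_forall fun t => ?_)
    have e : E.act (s * t) (htriv (s * t) x) v =
        E.act s (htriv s x) (E.act t (htriv t x) v) := E.act_mul s t x x x _ _ _ v
    have hc : (μ s : ℂ) * χ (s * t) = χ t := by
      simp only [χ, map_mul, mul_inv_rev, Circle.coe_mul, Circle.coe_inv]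
      field_simp
    change χ t * φ (E.act s (htriv s x) (E.act t (htriv t x) v)) =
      (μ s : ℂ) * (χ (s * t) * φ (E.act (s * t) (htriv (s * t) x) v))
    rw [e, ← mul_assoc, hc]
  · intro x v hv
    refine hsep x _ _ fun φ => ?_
    have hv' : ∀ t, χ t * φ (E.act t (htriv t x) v) = φ v := by
      intro t
      rw [hv t, map_smul, smul_eq_mul, ← mul_assoc]
      rw [hχ', one_mul]
    rw [hφ]
    simp [hv']

/-- The idempotents exhibiting the weight spaces as a retract. -/
def weightRetract (E : TBundle T X) (htriv : ∀ (t : T) (x : X), t • x = x) (μ : T →ₜ* Circle) :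
    Retract E.toVBundle :=
  let P := (E.exists_projection htriv μ).choose
  have hP := (E.exists_projection htriv μ).choose_spec
  { Q := fun x => E.weightSpace htriv μ x
    i := fun x => (E.weightSpace htriv μ x).subtype
    r := fun x => (P x).codRestrict _ (hP.2.1 x)
    r_i := fun x v => Subtype.ext (hP.2.2 x v.1 v.2)
    continuous_i_r := hP.1 }

/-- The isotypic subbundle `E_μ` of an equivariant bundle over a space on which `T` acts
trivially: its fibres are the subspaces on which `T` acts with weight `μ`. -/
def isotypic (E : TBundle T X) (htriv : ∀ (t : T) (x : X), t • x = x) (μ : T →ₜ* Circle) :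
    TBundle T X where
  toVBundle := (E.weightRetract htriv μ).bundle
  act t _ _ h := (E.act t h).restrict (E.act_mem_weightSpace htriv μ t h)
  act_one x h v := Subtype.ext (E.act_one x h v.1)
  act_mul s t x y z h₁ h₂ h₃ v := Subtype.ext (E.act_mul s t x y z h₁ h₂ h₃ v.1)
  continuous_act := by
    have h₁ := (E.weightRetract htriv μ).continuous_i.param (continuous_snd (X := T))
    have h₂ := E.continuous_act.comp h₁ continuous_snd
    have h₃ := (E.weightRetract htriv μ).continuous_r.param (E.continuous_proj_smul htriv)
    refine IsContFam.congr (h₃.comp h₂ (E.continuous_proj_smul htriv)) fun p => ?_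
    refine LinearMap.ext fun v => ?_
    exact (E.weightRetract htriv μ).r_i (p.1 • p.2)
      ((E.act p.1 rfl).restrict (E.act_mem_weightSpace htriv μ p.1 rfl) v)

/-- The idempotents exhibiting the quotients by the fixed subspaces as a retract. -/
def quotRetract (E : TBundle T X) (htriv : ∀ (t : T) (x : X), t • x = x) :
    Retract E.toVBundle :=
  let P := (E.exists_projection htriv 1).choose
  have hP := (E.exists_projection htriv 1).choose_spec
  { Q := fun x => E.fib x ⧸ E.fixedSpace htriv x
    i := fun x => (E.fixedSpace htriv x).liftQ (LinearMap.id + (-1 : ℂ) • P x) fun v hv => by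
      rw [← weightSpace_one] at hv
      simp [hP.2.2 x v hv, P]
    r := fun x => (E.fixedSpace htriv x).mkQ
    r_i := fun x v => by
      obtain ⟨v, rfl⟩ := Submodule.mkQ_surjective _ v
      have h := hP.2.1 x v
      rw [weightSpace_one] at h
      simpa [Submodule.Quotient.mk_eq_zero] using h
    continuous_i_r := IsContFam.congr ((isContFam_id E.toVBundle).add (hP.1.smul (-1)))
      fun _ => LinearMap.ext fun _ => rfl }

/-- The quotient `E / E^T` of an equivariant bundle over a space on which `T` acts trivially by
the subbundle of fixed vectors. -/
def modFixed (E : TBundle T X) (htriv : ∀ (t : T) (x : X), t • x = x) : TBundle T X where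
  toVBundle := (E.quotRetract htriv).bundle
  act t _ _ h := Submodule.mapQ _ _ (E.act t h) (E.act_mem_fixedSpace htriv t h)
  act_one x h v := by
    obtain ⟨v, rfl⟩ := Submodule.mkQ_surjective (E.fixedSpace htriv x) v
    exact congrArg _ (E.act_one x h v)
  act_mul s t x y z h₁ h₂ h₃ v := by
    obtain ⟨v, rfl⟩ := Submodule.mkQ_surjective (E.fixedSpace htriv x) v
    exact congrArg _ (E.act_mul s t x y z h₁ h₂ h₃ v)
  continuous_act := by
    have h₁ := (E.quotRetract htriv).continuous_i.param (continuous_snd (X := T))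
    have h₂ := E.continuous_act.comp h₁ continuous_snd
    have h₃ := (E.quotRetract htriv).continuous_r.param (E.continuous_proj_smul htriv)
    refine IsContFam.congr (h₃.comp h₂ (E.continuous_proj_smul htriv)) fun p => ?_
    refine LinearMap.ext fun v => ?_
    have h := (E.quotRetract htriv).r_i p.2 v
    have e : Submodule.mapQ _ _ (E.act p.1 rfl) (E.act_mem_fixedSpace htriv p.1 rfl)
        ((E.quotRetract htriv).r p.2 ((E.quotRetract htriv).i p.2 v)) =
        (E.quotRetract htriv).r (p.1 • p.2)
          (E.act p.1 rfl ((E.quotRetract htriv).i p.2 v)) := rfl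
    rw [h] at e
    exact e.symm

end TBundle

/-! ### Stably complex manifolds with a group action -/

section Manifold

variable {T : Type v} {M : Type u} [CommGroup T] [MulAction T M]

/-- The action `t_* : T_p M → T_q M` on tangent spaces, where `t • p = q`. -/
def push (n : ℕ) [TopologicalSpace M] [ChartedSpace (EuclideanSpace ℝ (Fin n)) M] (t : T)
    {p q : M} (h : t • p = q) :
    TangentSpace (𝓡 n) p →L[ℝ] TangentSpace (𝓡 n) q :=
  h ▸ mfderiv (𝓡 n) (𝓡 n) (fun x : M => t • x) p

/-- A stable (almost) complex structure on a `T`-manifold `M` of dimension `n`: a smooth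
`T`-equivariant complex structure `J` on the fibres of `TM ⊕ τ`, where `τ` is a product bundle
`M × ℝᵏ` with the trivial action on `ℝᵏ`. The total space of `TM ⊕ τ` is `TM × ℝᵏ`. -/
structure StableComplexStructure (n : ℕ) (T : Type v) (M : Type u) [CommGroup T]
    [TopologicalSpace M] [ChartedSpace (EuclideanSpace ℝ (Fin n)) M] [IsManifold (𝓡 n) ∞ M]
    [MulAction T M] where
  k : ℕ
  J : ∀ p : M, (TangentSpace (𝓡 n) p × EuclideanSpace ℝ (Fin k)) →ₗ[ℝ]
    (TangentSpace (𝓡 n) p × EuclideanSpace ℝ (Fin k))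
  J_J : ∀ p v, J p (J p v) = -v
  smooth_J : ContMDiff ((𝓡 n).tangent.prod 𝓘(ℝ, EuclideanSpace ℝ (Fin k)))
    ((𝓡 n).tangent.prod 𝓘(ℝ, EuclideanSpace ℝ (Fin k))) ∞
    (fun ξ : TangentBundle (𝓡 n) M × EuclideanSpace ℝ (Fin k) =>
      ((⟨ξ.1.proj, (J ξ.1.proj (ξ.1.snd, ξ.2)).1⟩, (J ξ.1.proj (ξ.1.snd, ξ.2)).2) :
        TangentBundle (𝓡 n) M × EuclideanSpace ℝ (Fin k)))
  equivariant_J : ∀ (t : T) (p q : M) (h : t • p = q) v,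
    J q (push n t h v.1, v.2) = (push n t h (J p v).1, (J p v).2)

/-- The fixed point set `M^T`. -/
def FixedSet (T : Type v) (M : Type u) [CommGroup T] [MulAction T M] : Type u :=
  {x : M // ∀ t : T, t • x = x}

namespace FixedSet

instance : MulAction T (FixedSet T M) where
  smul t x := ⟨t • x.1, fun s => by rw [x.2 t, x.2 s]⟩
  one_smul x := Subtype.ext (one_smul T x.1)
  mul_smul s t x := Subtype.ext (mul_smul s t x.1)

theorem smul_eq (t : T) (x : FixedSet T M) : t • x = x := Subtype.ext (x.2 t)

theorem coe_smul (t : T) (x : FixedSet T M) : (t • x).1 = t • x.1 := rfl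

variable [TopologicalSpace M]

instance : TopologicalSpace (FixedSet T M) := instTopologicalSpaceSubtype

theorem continuous_val : Continuous fun x : FixedSet T M => x.1 := continuous_subtype_val

/-- A connected component `W` of `M^T`, as a space. -/
def Component (W : ConnectedComponents (FixedSet T M)) : Type u :=
  {x : FixedSet T M // ConnectedComponents.mk x = W}

instance (W : ConnectedComponents (FixedSet T M)) : TopologicalSpace (Component W) :=
  instTopologicalSpaceSubtype

instance (W : ConnectedComponents (FixedSet T M)) : MulAction T (Component W) where
  smul t x := ⟨t • x.1, by rw [smul_eq, x.2]⟩
  one_smul x := Subtype.ext (one_smul T x.1)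
  mul_smul s t x := Subtype.ext (mul_smul s t x.1)

theorem Component.smul_eq {W : ConnectedComponents (FixedSet T M)} (t : T) (x : Component W) :
    t • x = x := Subtype.ext (FixedSet.smul_eq t x.1)

instance [TopologicalSpace T] (W : ConnectedComponents (FixedSet T M)) :
    ContinuousSMul T (Component W) where
  continuous_smul := by
    simp only [Component.smul_eq]
    exact continuous_snd

end FixedSet

section Push

variable {n : ℕ} [TopologicalSpace M] [ChartedSpace (EuclideanSpace ℝ (Fin n)) M]

theorem push_eq (t : T) {p q : M} (h : t • p = q) (v : TangentSpace (𝓡 n) p) :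
    (push n t h v : EuclideanSpace ℝ (Fin n)) =
      mfderiv (𝓡 n) (𝓡 n) (fun x : M => t • x) p v := by
  subst h
  rfl

theorem push_one (p : M) (h : (1 : T) • p = p) (v : TangentSpace (𝓡 n) p) : push n 1 h v = v := by
  have key : ∀ f : M → M, f = id →
      (mfderiv (𝓡 n) (𝓡 n) f p v : EuclideanSpace ℝ (Fin n)) = v := by
    rintro f rfl
    rw [mfderiv_id]
    rfl
  exact (push_eq 1 h v).trans (key _ (funext fun x => one_smul T x))

variable [TopologicalSpace T]

theorem mdifferentiable_smul (d : ℕ) [ChartedSpace (EuclideanSpace ℝ (Fin d)) T]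
    [ContMDiffSMul (𝓡 d) (𝓡 n) ∞ T M] (t : T) :
    MDifferentiable (𝓡 n) (𝓡 n) (fun x : M => t • x) := by
  have h : ContMDiff (𝓡 n) (𝓡 n) ∞ (fun x : M => t • x) :=
    (ContMDiffSMul.contMDiff_smul (I := 𝓡 d) (I' := 𝓡 n) (n := ∞) (G := T) (M := M)).comp
      (contMDiff_const.prodMk contMDiff_id)
  exact h.mdifferentiable (by simp)

theorem push_mul (d : ℕ) [ChartedSpace (EuclideanSpace ℝ (Fin d)) T]
    [ContMDiffSMul (𝓡 d) (𝓡 n) ∞ T M] (s t : T) {p q r : M} (h₁ : t • p = q) (h₂ : s • q = r)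
    (h₃ : (s * t) • p = r) (v : TangentSpace (𝓡 n) p) :
    push n (s * t) h₃ v = push n s h₂ (push n t h₁ v) := by
  subst h₁
  have key : ∀ f : M → M, f = (fun x : M => s • x) ∘ (fun x : M => t • x) →
      (mfderiv (𝓡 n) (𝓡 n) f p v : EuclideanSpace ℝ (Fin n)) =
        mfderiv (𝓡 n) (𝓡 n) (fun x : M => s • x) (t • p)
          (mfderiv (𝓡 n) (𝓡 n) (fun x : M => t • x) p v) := by
    rintro f rfl
    rw [mfderiv_comp p (mdifferentiable_smul d s (t • p)) (mdifferentiable_smul d t p)]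
    rfl
  refine (push_eq (s * t) h₃ v).trans ((key _ (funext fun x => mul_smul s t x)).trans ?_)
  exact (push_eq s h₂ _).symm

theorem continuous_push [IsManifold (𝓡 n) ∞ M] (d : ℕ) [ChartedSpace (EuclideanSpace ℝ (Fin d)) T]
    [LieGroup (𝓡 d) ∞ T] [ContMDiffSMul (𝓡 d) (𝓡 n) ∞ T M] :
    Continuous fun q : T × TangentBundle (𝓡 n) M =>
      (⟨q.1 • q.2.proj, push n q.1 rfl q.2.snd⟩ : TangentBundle (𝓡 n) M) := by
  have hA : ContMDiff ((𝓡 d).prod (𝓡 n)) (𝓡 n) ∞ (fun q : T × M => q.1 • q.2) :=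
    ContMDiffSMul.contMDiff_smul
  have hT : Continuous (tangentMap ((𝓡 d).prod (𝓡 n)) (𝓡 n) (fun q : T × M => q.1 • q.2)) :=
    hA.continuous_tangentMap (by simp)
  have h₀ : Continuous fun t : T => (⟨t, 0⟩ : TangentBundle (𝓡 d) T) :=
    Bundle.Trivialization.continuous_zeroSection (F := EuclideanSpace ℝ (Fin d))
      (E := (TangentSpace (𝓡 d) : T → Type)) ℝ
  have h₁ : Continuous fun q : T × TangentBundle (𝓡 n) M =>
      (equivTangentBundleProd (𝓡 d) T (𝓡 n) M).symm
        ((⟨q.1, 0⟩ : TangentBundle (𝓡 d) T), q.2) :=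
    (contMDiff_equivTangentBundleProd_symm (n := 0)).continuous.comp
      ((h₀.comp continuous_fst).prodMk continuous_snd)
  refine (hT.comp h₁).congr fun q => ?_
  have hd : mfderiv (𝓡 n) (𝓡 n) (fun x : M => q.1 • x) q.2.proj q.2.snd =
      mfderiv ((𝓡 d).prod (𝓡 n)) (𝓡 n) (fun q : T × M => q.1 • q.2) (q.1, q.2.proj)
        (0, q.2.snd) := by
    have hc : (fun x : M => q.1 • x) = (fun q : T × M => q.1 • q.2) ∘ fun x : M => (q.1, x) := rfl
    rw [hc, mfderiv_comp q.2.proj (hA.mdifferentiable (by simp) _)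
      ((contMDiff_const.prodMk contMDiff_id : ContMDiff (𝓡 n) ((𝓡 d).prod (𝓡 n)) ∞
        (fun x : M => (q.1, x))).mdifferentiable (by simp) _), mfderiv_prod_right]
    rfl
  exact congrArg (fun u => (⟨q.1 • q.2.proj, u⟩ : TangentBundle (𝓡 n) M)) hd.symm

end Push

end Manifold

/-! ### The stable tangent bundle as an equivariant complex vector bundle -/

section StableTangent

variable {M : Type u} [TopologicalSpace M] {n : ℕ} [ChartedSpace (EuclideanSpace ℝ (Fin n)) M]
  [IsManifold (𝓡 n) ∞ M]

/-- The fibre of `TM ⊕ τ` at `p`, as a real vector space. -/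
abbrev RFib (n k : ℕ) {M : Type u} [TopologicalSpace M] [ChartedSpace (EuclideanSpace ℝ (Fin n)) M]
    (p : M) : Type :=
  TangentSpace (𝓡 n) p × EuclideanSpace ℝ (Fin k)

/-- The trivialization of the tangent bundle given by the preferred chart at `p₀`. -/
abbrev triv (n : ℕ) {M : Type u} [TopologicalSpace M] [ChartedSpace (EuclideanSpace ℝ (Fin n)) M]
    [IsManifold (𝓡 n) ∞ M] (p₀ : M) :
    Bundle.Trivialization (EuclideanSpace ℝ (Fin n))
      (Bundle.TotalSpace.proj : TangentBundle (𝓡 n) M → M) :=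
  haveI : IsManifold (𝓡 n) 1 M := IsManifold.of_le (n := ∞) (by simp)
  trivializationAt (EuclideanSpace ℝ (Fin n)) (TangentSpace (𝓡 n)) p₀

/-- The local frame of `TM ⊕ τ` over the chart at `p₀`. -/
def realFrame (k : ℕ) (p₀ p : M) (h : p ∈ (triv n p₀).baseSet) :
    Basis (Fin n ⊕ Fin k) ℝ (RFib n k p) :=
  haveI : IsManifold (𝓡 n) 1 M := IsManifold.of_le (n := ∞) (by simp)
  ((EuclideanSpace.basisFun (Fin n) ℝ).toBasis.map
    ((triv n p₀).continuousLinearEquivAt ℝ p h).symm.toLinearEquiv).prod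
    (EuclideanSpace.basisFun (Fin k) ℝ).toBasis

theorem continuous_realFrame (k : ℕ) (p₀ : M) (j : Fin n ⊕ Fin k) :
    Continuous fun p : {p : M // p ∈ (triv n p₀).baseSet} =>
      ((⟨p.1, (realFrame k p₀ p.1 p.2 j).1⟩, (realFrame k p₀ p.1 p.2 j).2) :
        TangentBundle (𝓡 n) M × EuclideanSpace ℝ (Fin k)) := by
  have : IsManifold (𝓡 n) 1 M := IsManifold.of_le (n := ∞) (by simp)
  have hc : ∀ u : EuclideanSpace ℝ (Fin n),
      Continuous fun p : {p : M // p ∈ (triv n p₀).baseSet} =>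
        (⟨p.1, ((triv n p₀).continuousLinearEquivAt ℝ p.1 p.2).symm u⟩ :
          TangentBundle (𝓡 n) M) := by
    intro u
    have h := (triv n p₀).continuousOn_symm.comp_continuous
      (f := fun p : {p : M // p ∈ (triv n p₀).baseSet} => (p.1, u)) (by fun_prop)
      fun p => ⟨p.2, trivial⟩
    exact h.congr fun p => rfl
  rcases j with j | j
  · refine Continuous.prodMk ?_ ?_
    · refine (hc ((EuclideanSpace.basisFun (Fin n) ℝ).toBasis j)).congr fun p => ?_
      simp [realFrame]
    · simp only [realFrame, Basis.prod_apply_inl_snd]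
      exact continuous_const
  · refine Continuous.prodMk ?_ ?_
    · refine (hc 0).congr fun p => ?_
      simp only [realFrame, Basis.prod_apply_inr_fst, map_zero]
    · simp only [realFrame, Basis.prod_apply_inr_snd]
      exact continuous_const

theorem continuous_realFrame_repr (k : ℕ) (p₁ : M) {Z : Type*} [TopologicalSpace Z] (b : Z → M)
    (hb : ∀ z, b z ∈ (triv n p₁).baseSet) (w : ∀ z, RFib n k (b z))
    (hw : Continuous fun z => ((⟨b z, (w z).1⟩, (w z).2) :
        TangentBundle (𝓡 n) M × EuclideanSpace ℝ (Fin k))) (i : Fin n ⊕ Fin k) :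
    Continuous fun z => (realFrame k p₁ (b z) (hb z)).repr (w z) i := by
  have : IsManifold (𝓡 n) 1 M := IsManifold.of_le (n := ∞) (by simp)
  rcases i with i | i
  · have h := (triv n p₁).continuousOn.comp_continuous hw.fst
      fun z => (triv n p₁).mem_source.2 (hb z)
    have h' : Continuous fun z => ((triv n p₁) ⟨b z, (w z).1⟩).2 i :=
      (by fun_prop : Continuous fun u : EuclideanSpace ℝ (Fin n) => u i).comp h.snd
    refine h'.congr fun z => ?_
    simp [realFrame, Basis.prod_repr_inl]
  · have h' : Continuous fun z => (w z).2 i :=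
      (by fun_prop : Continuous fun u : EuclideanSpace ℝ (Fin k) => u i).comp hw.snd
    refine h'.congr fun z => ?_
    simp [realFrame, Basis.prod_repr_inr]

theorem continuous_baseChange (k : ℕ) {Z : Type*} [TopologicalSpace Z] {a b : Z → M}
    (φ : ∀ z, RFib n k (a z) →ₗ[ℝ] RFib n k (b z))
    (hφ : ∀ p₀ j, Continuous fun z : {z : Z // a z ∈ (triv n p₀).baseSet} =>
      ((⟨b z.1, (φ z.1 (realFrame k p₀ (a z.1) z.2 j)).1⟩,
        (φ z.1 (realFrame k p₀ (a z.1) z.2 j)).2) :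
        TangentBundle (𝓡 n) M × EuclideanSpace ℝ (Fin k))) (p₀ p₁ : M) (j i) :
    Continuous fun z : {z : Z // a z ∈ (triv n p₀).baseSet ∧ b z ∈ (triv n p₁).baseSet} =>
      ((realFrame k p₁ (b z.1) z.2.2).baseChange ℂ).repr
        ((φ z.1).baseChange ℂ ((realFrame k p₀ (a z.1) z.2.1).baseChange ℂ j)) i := by
  simp only [Basis.baseChange_apply, LinearMap.baseChange_tmul, Basis.baseChange_repr_tmul]
  simp only [Algebra.smul_def, mul_one]
  refine Complex.continuous_ofReal.comp ?_
  refine continuous_realFrame_repr k p₁ _ _ _ ?_ i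
  exact (hφ p₀ j).comp
    (f := fun z : {z : Z // a z ∈ (triv n p₀).baseSet ∧ b z ∈ (triv n p₁).baseSet} =>
      (⟨z.1, z.2.1⟩ : {z : Z // a z ∈ (triv n p₀).baseSet}))
    (continuous_subtype_val.subtype_mk _)

/-- The complexification of `TM ⊕ τ`. -/
def complexified (n k : ℕ) (M : Type u) [TopologicalSpace M]
    [ChartedSpace (EuclideanSpace ℝ (Fin n)) M] [IsManifold (𝓡 n) ∞ M] : VBundle M where
  fib p := ℂ ⊗[ℝ] RFib n k p
  nhd p := (triv n p).baseSet
  isOpen_nhd p := (triv n p).open_baseSet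
  mem_nhd p := FiberBundle.mem_baseSet_trivializationAt' p
  idx _ := Fin n ⊕ Fin k
  frame p₀ p h := (realFrame k p₀ p h).baseChange ℂ
  continuous_transition p₀ p₁ j i := by
    simpa using continuous_baseChange k (a := id) (b := id) (fun p => LinearMap.id)
      (fun p₀ j => continuous_realFrame k p₀ j) p₀ p₁ j i

theorem isContFam_baseChange (k : ℕ) {Z : Type*} [TopologicalSpace Z] {a b : Z → M}
    (φ : ∀ z, RFib n k (a z) →ₗ[ℝ] RFib n k (b z))
    (hφ : ∀ p₀ j, Continuous fun z : {z : Z // a z ∈ (triv n p₀).baseSet} =>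
      ((⟨b z.1, (φ z.1 (realFrame k p₀ (a z.1) z.2 j)).1⟩,
        (φ z.1 (realFrame k p₀ (a z.1) z.2 j)).2) :
        TangentBundle (𝓡 n) M × EuclideanSpace ℝ (Fin k))) :
    IsContFam (complexified n k M) (complexified n k M) a b fun z => (φ z).baseChange ℂ :=
  fun p₀ p₁ j i => continuous_baseChange k φ hφ p₀ p₁ j i

end StableTangent

namespace StableComplexStructure

variable {n : ℕ} {T : Type v} {M : Type u} [CommGroup T] [TopologicalSpace M]
  [ChartedSpace (EuclideanSpace ℝ (Fin n)) M] [IsManifold (𝓡 n) ∞ M] [MulAction T M]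
  (S : StableComplexStructure n T M)

/-- The fibre of `TM ⊕ τ` at `p`. -/
def Fib (p : M) : Type := RFib n S.k p

instance (p : M) : AddCommGroup (S.Fib p) := inferInstanceAs (AddCommGroup (RFib n S.k p))

instance (p : M) : Module ℝ (S.Fib p) := inferInstanceAs (Module ℝ (RFib n S.k p))

/-- The complex structure of a fibre, as an endomorphism. -/
def jEnd (p : M) : Module.End ℝ (S.Fib p) := S.J p

theorem jEnd_jEnd (p : M) (v : S.Fib p) : S.jEnd p (S.jEnd p v) = -v := S.J_J p v

/-- The complex vector space structure of the fibres of `TM ⊕ τ`, in which `i` acts as `J`. -/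
instance (p : M) : Module ℂ (S.Fib p) :=
  Module.compHom _ (Complex.lift ⟨S.jEnd p, LinearMap.ext fun v => S.jEnd_jEnd p v⟩ :
    ℂ →ₐ[ℝ] Module.End ℝ (S.Fib p)).toRingHom

theorem smul_def (p : M) (z : ℂ) (v : S.Fib p) : z • v = z.re • v + z.im • S.jEnd p v := rfl

instance (p : M) : IsScalarTower ℝ ℂ (S.Fib p) where
  smul_assoc a z v := by
    have h : (a • z).re • v + (a • z).im • S.jEnd p v =
        a • (z.re • v + z.im • S.jEnd p v) := by
      rw [Complex.smul_re, Complex.smul_im, smul_eq_mul, smul_eq_mul, mul_smul, mul_smul,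
        ← smul_add]
    exact h

theorem I_smul (p : M) (v : S.Fib p) : Complex.I • v = S.jEnd p v := by
  simp [smul_def]

/-- A real linear map between fibres that commutes with `J` is complex linear. -/
def ofReal {p q : M} (φ : RFib n S.k p →ₗ[ℝ] RFib n S.k q)
    (hφ : ∀ v, S.J q (φ v) = φ (S.J p v)) : S.Fib p →ₗ[ℂ] S.Fib q where
  toFun v := φ v
  map_add' v w := map_add φ v w
  map_smul' z v := by
    have h₁ : ∀ v : RFib n S.k p, φ (z.re • v + z.im • S.J p v) =
        z.re • φ v + z.im • S.J q (φ v) := fun v => by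
      rw [map_add, map_smul, map_smul, hφ v]
    exact h₁ v

/-- `v ↦ (1 ⊗ v - i ⊗ J v) / 2`. -/
def incl (p : M) : S.Fib p →ₗ[ℂ] ℂ ⊗[ℝ] S.Fib p where
  toFun v := (1 / 2 : ℂ) • ((1 : ℂ) ⊗ₜ[ℝ] v - Complex.I ⊗ₜ[ℝ] S.jEnd p v)
  map_add' v w := by
    rw [← smul_add, map_add, TensorProduct.tmul_add, TensorProduct.tmul_add]
    congr 1
    abel
  map_smul' z v := by
    rw [RingHom.id_apply, smul_comm z]
    congr 1
    have h₁ : z = ((z.re : ℝ) : ℂ) + ((z.im : ℝ) : ℂ) * Complex.I := (Complex.re_add_im z).symm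
    rw [smul_def, map_add, map_smul, map_smul, jEnd_jEnd, TensorProduct.tmul_add,
      TensorProduct.tmul_add, TensorProduct.tmul_smul, TensorProduct.tmul_smul,
      TensorProduct.tmul_smul, TensorProduct.tmul_smul, TensorProduct.tmul_neg]
    simp only [TensorProduct.smul_tmul', smul_sub, ← TensorProduct.neg_tmul]
    have e₁ : z • (1 : ℂ) = z.re • (1 : ℂ) + z.im • Complex.I := by
      simp
    have e₂ : z • Complex.I = z.re • Complex.I + - (z.im • (1 : ℂ)) := by
      simp only [smul_eq_mul, Complex.real_smul]
      conv_lhs => rw [h₁, add_mul, mul_assoc, Complex.I_mul_I]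
      ring
    rw [e₁, e₂, TensorProduct.add_tmul, TensorProduct.add_tmul, TensorProduct.neg_tmul, smul_neg,
      TensorProduct.neg_tmul]
    abel

/-- `z ⊗ v ↦ z v`. -/
def retr (p : M) : ℂ ⊗[ℝ] S.Fib p →ₗ[ℂ] S.Fib p :=
  LinearMap.liftBaseChange ℂ LinearMap.id

theorem retr_incl (p : M) (v : S.Fib p) : S.retr p (S.incl p v) = v := by
  have h : S.incl p v = (1 / 2 : ℂ) • ((1 : ℂ) ⊗ₜ[ℝ] v - Complex.I ⊗ₜ[ℝ] S.jEnd p v) := rfl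
  rw [h, map_smul, map_sub]
  simp only [retr, LinearMap.liftBaseChange_tmul, LinearMap.id_apply, one_smul, I_smul, jEnd_jEnd,
    sub_neg_eq_add]
  rw [← two_smul ℂ v, smul_smul]
  norm_num

theorem incl_retr (p : M) :
    S.incl p ∘ₗ S.retr p = (1 / 2 : ℂ) • LinearMap.id +
      (-(Complex.I / 2)) • (S.jEnd p).baseChange ℂ := by
  refine TensorProduct.AlgebraTensorModule.curry_injective ?_
  refine LinearMap.ext_ring ?_
  refine LinearMap.ext fun v => ?_
  change S.incl p (S.retr p (1 ⊗ₜ v)) = (1 / 2 : ℂ) • ((1 : ℂ) ⊗ₜ[ℝ] v) +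
      (-(Complex.I / 2)) • ((S.jEnd p).baseChange ℂ (1 ⊗ₜ v))
  have h : S.incl p v = (1 / 2 : ℂ) • ((1 : ℂ) ⊗ₜ[ℝ] v - Complex.I ⊗ₜ[ℝ] S.jEnd p v) := rfl
  rw [retr, LinearMap.liftBaseChange_tmul, LinearMap.id_apply, one_smul, h,
    LinearMap.baseChange_tmul, smul_sub, sub_eq_add_neg, TensorProduct.smul_tmul',
    TensorProduct.smul_tmul', TensorProduct.smul_tmul', ← TensorProduct.neg_tmul]
  congr 2
  simp only [smul_eq_mul]
  ring

theorem continuous_J : IsContFam (complexified n S.k M) (complexified n S.k M) id id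
    fun p => (S.J p).baseChange ℂ :=
  isContFam_baseChange S.k (a := id) (b := id) S.J fun p₀ j =>
    S.smooth_J.continuous.comp (continuous_realFrame S.k p₀ j)

/-- `(TM ⊕ τ, J)` as a retract of the complexification of `TM ⊕ τ`. -/
def retract : Retract (complexified n S.k M) where
  Q := S.Fib
  i := S.incl
  r := S.retr
  r_i := S.retr_incl
  continuous_i_r := by
    have h := ((isContFam_id (complexified n S.k M)).smul (1 / 2)).add
      (S.continuous_J.smul (-(Complex.I / 2)))
    exact h.congr fun p => (S.incl_retr p).symm

theorem baseChange_incl {p q : M} (φ : S.Fib p →ₗ[ℝ] S.Fib q)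
    (hφ : ∀ v, S.J q (φ v) = φ (S.J p v)) (v : S.Fib p) :
    S.retr q (φ.baseChange ℂ (S.incl p v)) = S.ofReal φ hφ v := by
  have h : S.incl p v = (1 / 2 : ℂ) • ((1 : ℂ) ⊗ₜ[ℝ] v - Complex.I ⊗ₜ[ℝ] S.jEnd p v) := rfl
  have h' : φ.baseChange ℂ (S.incl p v) =
      S.incl q (S.ofReal φ hφ v) := by
    have e : φ (S.jEnd p v) = S.jEnd q (S.ofReal φ hφ v) := (hφ v).symm
    have h₂ : S.incl q (S.ofReal φ hφ v) = (1 / 2 : ℂ) • ((1 : ℂ) ⊗ₜ[ℝ] (S.ofReal φ hφ v) -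
      Complex.I ⊗ₜ[ℝ] S.jEnd q (S.ofReal φ hφ v)) := rfl
    have e' : φ v = S.ofReal φ hφ v := rfl
    rw [h, h₂, map_smul, map_sub, LinearMap.baseChange_tmul, LinearMap.baseChange_tmul, e, e']
  rw [h', retr_incl]

/-- The action of `t` on the fibres of `TM ⊕ τ`, trivial on the summand `τ`. -/
def pushSum (t : T) {p q : M} (h : t • p = q) : RFib n S.k p →ₗ[ℝ] RFib n S.k q :=
  (push n t h).toLinearMap.prodMap LinearMap.id

variable [TopologicalSpace T]

/-- The `T`-equivariant complex vector bundle `(TM ⊕ τ, J)`. -/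
def stableTangent (d : ℕ) [ChartedSpace (EuclideanSpace ℝ (Fin d)) T] [LieGroup (𝓡 d) ∞ T]
    [ContMDiffSMul (𝓡 d) (𝓡 n) ∞ T M] : TBundle T M where
  toVBundle := S.retract.bundle
  act t p q h := S.ofReal (S.pushSum t h) fun v => S.equivariant_J t p q h v
  act_one p h v := Prod.ext (push_one p h v.1) rfl
  act_mul s t p q r h₁ h₂ h₃ v := Prod.ext (push_mul d s t h₁ h₂ h₃ v.1) rfl
  continuous_act := by
    have hsm : Continuous fun p : T × M => p.1 • p.2 :=
      (ContMDiffSMul.contMDiff_smul (I := 𝓡 d) (I' := 𝓡 n) (n := ∞) (G := T) (M := M)).continuous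
    have h₀ : IsContFam (complexified n S.k M) (complexified n S.k M)
        (fun p : T × M => p.2) (fun p => p.1 • p.2)
        fun p => (S.pushSum p.1 rfl).baseChange ℂ := by
      refine isContFam_baseChange S.k (a := fun p : T × M => p.2) (b := fun p => p.1 • p.2)
        (fun p => S.pushSum p.1 rfl) fun p₀ j => ?_
      have hf := (continuous_realFrame S.k p₀ j).comp
        (f := fun z : {z : T × M // z.2 ∈ (triv n p₀).baseSet} =>
          (⟨z.1.2, z.2⟩ : {p : M // p ∈ (triv n p₀).baseSet})) (by fun_prop)
      have hz : Continuous fun z : {z : T × M // z.2 ∈ (triv n p₀).baseSet} => z.1.1 := by fun_prop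
      exact ((continuous_push d).comp (hz.prodMk hf.fst)).prodMk hf.snd
    have h₁ := S.retract.continuous_i.param (continuous_snd (X := T) (Y := M))
    have h₂ := h₀.comp h₁ continuous_snd
    have h₃ := S.retract.continuous_r.param hsm
    refine IsContFam.congr (h₃.comp h₂ hsm) fun p => ?_
    exact LinearMap.ext fun v => S.baseChange_incl (S.pushSum p.1 rfl) _ v

end StableComplexStructure

/-! ### The star product -/

section LogWeight

/-- The logweight `a_μ(t) ∈ [0, 1)`, characterized by `μ(t) = exp(2πi a_μ(t))`. -/
def logWeight {T : Type v} [Group T] [TopologicalSpace T] (μ : T →ₜ* Circle) (t : T) : ℝ :=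
  Int.fract (Complex.arg (μ t) / (2 * Real.pi))

variable {T : Type v} [Group T] [TopologicalSpace T] (μ : T →ₜ* Circle)

theorem logWeight_nonneg (t : T) : 0 ≤ logWeight μ t := Int.fract_nonneg _

theorem logWeight_lt_one (t : T) : logWeight μ t < 1 := Int.fract_lt_one _

theorem exp_logWeight (t : T) :
    Complex.exp (2 * Real.pi * Complex.I * logWeight μ t) = (μ t : ℂ) := by
  have h : (logWeight μ t : ℂ) = (Complex.arg (μ t) : ℂ) / (2 * Real.pi) -
      (⌊Complex.arg (μ t) / (2 * Real.pi)⌋ : ℂ) := by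
    rw [logWeight, Int.fract]
    push_cast
    rfl
  have hpi : (Real.pi : ℂ) ≠ 0 := by exact_mod_cast Real.pi_ne_zero
  have e : 2 * Real.pi * Complex.I * logWeight μ t = (Complex.arg (μ t) : ℂ) * Complex.I -
      (⌊Complex.arg (μ t) / (2 * Real.pi)⌋ : ℂ) * (2 * Real.pi * Complex.I) := by
    rw [h]
    field_simp
  rw [e, Complex.exp_sub, Complex.exp_int_mul_two_pi_mul_I, div_one]
  have hn : ‖(μ t : ℂ)‖ = 1 := Circle.norm_coe _
  have := Complex.norm_mul_exp_arg_mul_I (μ t : ℂ)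
  rwa [hn, Complex.ofReal_one, one_mul] at this

/-- The exponent `a_μ(t₁) + a_μ(t₂) - a_μ(t₁ t₂)`, which is `0` or `1`, as a natural number. -/
def twistExponent (t₁ t₂ : T) : ℕ :=
  ⌊logWeight μ t₁ + logWeight μ t₂ - logWeight μ (t₁ * t₂)⌋₊

theorem twistExponent_eq (t₁ t₂ : T) :
    (twistExponent μ t₁ t₂ : ℝ) = logWeight μ t₁ + logWeight μ t₂ - logWeight μ (t₁ * t₂) := by
  have hexp : Complex.exp
      (2 * Real.pi * Complex.I * (logWeight μ t₁ + logWeight μ t₂ - logWeight μ (t₁ * t₂))) = 1 := by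
    rw [mul_sub, mul_add, Complex.exp_sub, Complex.exp_add, exp_logWeight, exp_logWeight,
      exp_logWeight, map_mul, Circle.coe_mul]
    exact div_self (mul_ne_zero (Circle.coe_ne_zero _) (Circle.coe_ne_zero _))
  obtain ⟨m, hm⟩ := Complex.exp_eq_one_iff.1 hexp
  have hm' : logWeight μ t₁ + logWeight μ t₂ - logWeight μ (t₁ * t₂) = (m : ℝ) := by
    have h2 : (2 * Real.pi * Complex.I : ℂ) ≠ 0 := Complex.two_pi_I_ne_zero
    rw [mul_comm (m : ℂ)] at hm
    have := mul_left_cancel₀ h2 hm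
    exact_mod_cast this
  have hlow : (-1 : ℝ) < m := by
    rw [← hm']
    linarith [logWeight_nonneg μ t₁, logWeight_nonneg μ t₂, logWeight_lt_one μ (t₁ * t₂)]
  have hm0 : 0 ≤ m := by
    have : (-1 : ℤ) < m := by exact_mod_cast hlow
    omega
  obtain ⟨k, rfl⟩ := Int.eq_ofNat_of_zero_le hm0
  rw [twistExponent, hm']
  simp

end LogWeight

namespace FixedSet

variable {T : Type v} {M : Type u} [CommGroup T] [TopologicalSpace T] [TopologicalSpace M]
  [MulAction T M]

/-- The restriction of an equivariant bundle to `M^T`. -/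
def restrictBundle (E : TBundle T M) : TBundle T (FixedSet T M) :=
  E.pullback (fun x => x.1) continuous_val fun _ _ => rfl

/-- The restriction of an equivariant bundle to a component `W` of `M^T`. -/
def Component.restrictBundle (E : TBundle T (FixedSet T M))
    (W : ConnectedComponents (FixedSet T M)) : TBundle T (Component W) :=
  E.pullback (fun x => x.1) continuous_subtype_val fun _ _ => rfl

/-- The restriction `K_T(M^T) → K_T(W)`. -/
def Component.restrict (W : ConnectedComponents (FixedSet T M)) :
    KT T (FixedSet T M) →+* KT T (Component W) :=
  KT.pullback (fun x => x.1) continuous_subtype_val fun _ _ => rfl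

end FixedSet

/-- The abelian group `K_T(X) ⊗ ℤ[T]`. -/
abbrev StarModule (T : Type v) (X : Type u) [CommGroup T] [TopologicalSpace T] [TopologicalSpace X]
    [MulAction T X] :=
  KT T X ⊗[ℤ] MonoidAlgebra ℤ T

/-- The element `σ ⊗ t` of `K_T(X) ⊗ ℤ[T]`. -/
def pureTensor {T : Type v} {X : Type u} [CommGroup T] [TopologicalSpace T] [TopologicalSpace X]
    [MulAction T X] (σ : KT T X) (t : T) : StarModule T X :=
  σ ⊗ₜ[ℤ] MonoidAlgebra.of ℤ T t

namespace StableComplexStructure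

open FixedSet

variable {n : ℕ} {T : Type v} {M : Type u} [CommGroup T] [TopologicalSpace T] [CompactSpace T]
  [TopologicalSpace M] [ChartedSpace (EuclideanSpace ℝ (Fin n)) M] [IsManifold (𝓡 n) ∞ M]
  [MulAction T M] (S : StableComplexStructure n T M)
  (d : ℕ) [ChartedSpace (EuclideanSpace ℝ (Fin d)) T] [LieGroup (𝓡 d) ∞ T]
  [ContMDiffSMul (𝓡 d) (𝓡 n) ∞ T M]

/-- The normal bundle `ν(W, M)` of a component `W` of `M^T`, as a `T`-equivariant complex vector
bundle: the quotient of `TM ⊕ τ` restricted to `W` by `TW ⊕ τ`. Here the tangent space `T_p W` is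
the subspace of fixed vectors of `T_p M`, so that `T_p W ⊕ τ_p` is the complex subspace of fixed
vectors of `T_p M ⊕ τ_p`. -/
def normalBundle (W : ConnectedComponents (FixedSet T M)) : TBundle T (Component W) :=
  haveI : IsTopologicalGroup T := topologicalGroup_of_lieGroup (𝓡 d) ∞
  (Component.restrictBundle (restrictBundle (S.stableTangent d)) W).modFixed Component.smul_eq

/-- The isotypic component `I_μ` of the normal bundle `ν(W, M)`. -/
def normalIsotypic (W : ConnectedComponents (FixedSet T M)) (μ : T →ₜ* Circle) :
    TBundle T (Component W) :=
  haveI : IsTopologicalGroup T := topologicalGroup_of_lieGroup (𝓡 d) ∞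
  (S.normalBundle d W).isotypic Component.smul_eq μ

/-- The weights `μ` that occur in the normal bundle `ν(W, M)`. -/
def normalWeights (W : ConnectedComponents (FixedSet T M)) : Set (T →ₜ* Circle) :=
  {μ | ∃ p : Component W, Nontrivial ((S.normalIsotypic d W μ).fib p)}

/-- The product of the classes `ε(I_μ)^(a_μ(t₁) + a_μ(t₂) - a_μ(t₁ t₂))` over the isotypic
components `I_μ` of the normal bundle `ν(W, M)`. -/
def twistClass (W : ConnectedComponents (FixedSet T M)) (t₁ t₂ : T) : KT T (Component W) :=
  haveI : IsTopologicalGroup T := topologicalGroup_of_lieGroup (𝓡 d) ∞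
  ∏ᶠ μ ∈ S.normalWeights d W, KT.euler (S.normalIsotypic d W μ) ^ twistExponent μ t₁ t₂

/-- A biadditive product on `K_T(M^T) ⊗ ℤ[T]` is the star product if, on each component `W` of
`M^T`, the restriction of `(σ₁ ⊗ t₁) ⋆ (σ₂ ⊗ t₂)` is
`[σ₁|_W σ₂|_W ∏ ε(I_μ)^(a_μ(t₁) + a_μ(t₂) - a_μ(t₁ t₂))] ⊗ t₁ t₂`, the product being over the
isotypic components `I_μ` of `ν(W, M)`. -/
def IsStarProduct (star : StarModule T (FixedSet T M) →ₗ[ℤ] StarModule T (FixedSet T M) →ₗ[ℤ]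
    StarModule T (FixedSet T M)) : Prop :=
  ∀ (W : ConnectedComponents (FixedSet T M)) (σ₁ σ₂ : KT T (FixedSet T M)) (t₁ t₂ : T),
    (Component.restrict W).toIntAlgHom.toLinearMap.rTensor (MonoidAlgebra ℤ T)
      (star (pureTensor σ₁ t₁) (pureTensor σ₂ t₂)) =
    pureTensor (Component.restrict W σ₁ * Component.restrict W σ₂ * S.twistClass d W t₁ t₂)
      (t₁ * t₂)

end StableComplexStructure

end

end EquivK

/-!
A bundle on `M^T`, the disjoint union of its components `W`, is a family of bundles on the `W`, and
so is a stable isomorphism of bundles; hence `K_T(M^T) ≅ ∏ W, K_T(W)`. As `ℤ[T]` is free, an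
element of `K_T(M^T) ⊗ ℤ[T]` is then determined by its restrictions to the components, so that `⋆`
is unique.

For existence, the products of Euler classes glue to a function `c : T × T → K_T(M^T)`, and `⋆` is
the product of the free `K_T(M^T)`-module on `T` twisted by `c`. The exponent of `ε(I_μ)` is the
coboundary of `a_μ`, so `c` is a symmetric normalised `2`-cocycle, which makes `⋆` commutative,
unital and associative. The cocycle identity is checked factor by factor, for which the product must
be finite: over the connected space `W` an isotypic component that is nonzero at one point is
nonzero at every point, and vectors of distinct weights in a single fibre are linearly independent.
-/

namespace EquivK

noncomputable section

open Module

section OpenCover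

variable {X Y Z W ι : Type*} [TopologicalSpace X] [TopologicalSpace Y] [TopologicalSpace Z]
  [TopologicalSpace W] {U : ι → Type*} [∀ i, TopologicalSpace (U i)]

theorem continuous_subtype_of_openCover {P : Z → Prop} {f : {z // P z} → W} (g : ∀ i, U i → Z)
    (hg : ∀ i, Topology.IsOpenEmbedding (g i)) (hcover : ∀ z, ∃ i u, g i u = z)
    (hf : ∀ i, Continuous fun u : {u // P (g i u)} => f ⟨g i u, u.2⟩) : Continuous f := by
  refine continuous_iff_continuousAt.2 ?_
  rintro ⟨z, hz⟩
  obtain ⟨i, u, rfl⟩ := hcover z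
  have hrestrict := Set.restrictPreimage_isOpenEmbedding {z | P z} (hg i)
  exact (hrestrict.continuousAt_iff (x := ⟨u, hz⟩)).1 (hf i).continuousAt

theorem IsContFam.of_openCover {E : VBundle X} {F : VBundle Y} {a : Z → X} {b : Z → Y}
    {φ : ∀ z, E.fib (a z) →ₗ[ℂ] F.fib (b z)} (g : ∀ i, U i → Z)
    (hg : ∀ i, Topology.IsOpenEmbedding (g i)) (hcover : ∀ z, ∃ i u, g i u = z)
    (hφ : ∀ i, IsContFam E F (a ∘ g i) (b ∘ g i) fun u => φ (g i u)) : IsContFam E F a b φ :=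
  fun x₀ y₁ j k => continuous_subtype_of_openCover g hg hcover fun i => hφ i x₀ y₁ j k

end OpenCover

namespace VBundle

variable {ι : Type*} {Y : ι → Type*} [∀ i, TopologicalSpace (Y i)] (E : ∀ i, VBundle (Y i))

/-- The neighbourhood of a point of `Σ i, Y i` over which `VBundle.sigma` has its local frame. -/
def sigmaNhd (x₀ : Σ i, Y i) : Set (Σ i, Y i) :=
  {x | ∃ h : x₀.1 = x.1, x.2 ∈ (E x.1).nhd (h ▸ x₀.2)}

/-- The local frame of `VBundle.sigma` over `VBundle.sigmaNhd`. -/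
def sigmaFrame : ∀ {i j : ι} {y₀ : Y i} {y : Y j} (h : i = j), y ∈ (E j).nhd (h ▸ y₀) →
    Basis ((E i).idx y₀) ℂ ((E j).fib y)
  | i, _, y₀, y, rfl, hy => (E i).frame y₀ y hy

theorem mk_mem_sigmaNhd_mk {i : ι} {y₀ y : Y i} :
    ⟨i, y⟩ ∈ sigmaNhd E ⟨i, y₀⟩ ↔ y ∈ (E i).nhd y₀ :=
  ⟨fun h => h.2, fun h => ⟨rfl, h⟩⟩

theorem isOpen_sigmaNhd (x₀ : Σ i, Y i) : IsOpen (sigmaNhd E x₀) := by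
  obtain ⟨i, y₀⟩ := x₀
  refine isOpen_sigma_iff.2 fun j => ?_
  by_cases h : i = j
  · subst h
    have hpre : Sigma.mk i ⁻¹' sigmaNhd E ⟨i, y₀⟩ = (E i).nhd y₀ :=
      Set.ext fun _ => mk_mem_sigmaNhd_mk E
    exact hpre ▸ (E i).isOpen_nhd y₀
  · simp [sigmaNhd, h]

theorem continuous_sigmaFrame_transition (x₀ x₁ : Σ i, Y i) (j k) :
    Continuous fun x : {x // x ∈ sigmaNhd E x₀ ∧ x ∈ sigmaNhd E x₁} =>
      (sigmaFrame E x.2.2.1 x.2.2.2).repr (sigmaFrame E x.2.1.1 x.2.1.2 j) k := by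
  refine continuous_subtype_of_openCover (fun i => Sigma.mk i)
    (fun i => Topology.IsOpenEmbedding.sigmaMk) (fun x => ⟨x.1, x.2, rfl⟩) fun i => ?_
  by_cases h : x₀.1 = i ∧ x₁.1 = i
  · obtain ⟨⟨_, y₀⟩, ⟨_, y₁⟩⟩ := x₀, x₁
    obtain ⟨rfl, rfl⟩ := h
    exact ((E _).continuous_transition y₀ y₁ j k).comp
      (f := fun y : {y // ⟨_, y⟩ ∈ sigmaNhd E ⟨_, y₀⟩ ∧ ⟨_, y⟩ ∈ sigmaNhd E ⟨_, y₁⟩} =>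
        ⟨y.1, y.2.1.2, y.2.2.2⟩)
      (continuous_subtype_val.subtype_mk _)
  · exact continuous_iff_continuousAt.2 fun y => absurd ⟨y.2.1.1, y.2.2.1⟩ h

/-- The vector bundle on a disjoint union with restriction `E i` to the `i`-th summand. -/
def sigma : VBundle (Σ i, Y i) where
  fib x := (E x.1).fib x.2
  nhd := sigmaNhd E
  isOpen_nhd := isOpen_sigmaNhd E
  mem_nhd x := ⟨rfl, (E x.1).mem_nhd x.2⟩
  idx x := (E x.1).idx x.2
  frame _ _ h := sigmaFrame E h.1 h.2
  continuous_transition := continuous_sigmaFrame_transition E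

end VBundle

namespace IsContFam

theorem id_to_pullback {X Y : Type*} [TopologicalSpace X] [TopologicalSpace Y] (E : VBundle X)
    {f : Y → X} (hf : Continuous f) :
    IsContFam E (E.pullback f hf) f id fun _ => LinearMap.id :=
  fun x₀ y₁ j i => (isContFam_id E).param hf x₀ (f y₁) j i

theorem id_of_pullback {X Y : Type*} [TopologicalSpace X] [TopologicalSpace Y] (E : VBundle X)
    {f : Y → X} (hf : Continuous f) :
    IsContFam (E.pullback f hf) E id f fun _ => LinearMap.id :=
  fun y₀ x₁ j i => (isContFam_id E).param hf (f y₀) x₁ j i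

variable {ι : Type*} {Y : ι → Type*} [∀ i, TopologicalSpace (Y i)]

theorem id_to_sigma (E : ∀ i, VBundle (Y i)) (i : ι) :
    IsContFam (E i) (VBundle.sigma E) id (Sigma.mk i) fun _ => LinearMap.id := by
  intro y₀ x₁ j k
  have h := (isContFam_id (VBundle.sigma E)).param (continuous_sigmaMk (i := i)) ⟨i, y₀⟩ x₁ j k
  exact h.comp (f := fun y : {y // y ∈ (E i).nhd y₀ ∧ ⟨i, y⟩ ∈ VBundle.sigmaNhd E x₁} =>
    ⟨y.1, (VBundle.mk_mem_sigmaNhd_mk E).2 y.2.1, y.2.2⟩) (continuous_subtype_val.subtype_mk _)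

theorem id_of_sigma (E : ∀ i, VBundle (Y i)) (i : ι) :
    IsContFam (VBundle.sigma E) (E i) (Sigma.mk i) id fun _ => LinearMap.id := by
  intro x₀ y₁ j k
  have h := (isContFam_id (VBundle.sigma E)).param (continuous_sigmaMk (i := i)) x₀ ⟨i, y₁⟩ j k
  exact h.comp (f := fun y : {y // ⟨i, y⟩ ∈ VBundle.sigmaNhd E x₀ ∧ y ∈ (E i).nhd y₁} =>
    ⟨y.1, y.2.1, (VBundle.mk_mem_sigmaNhd_mk E).2 y.2.2⟩) (continuous_subtype_val.subtype_mk _)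

theorem of_pullback_sigmaMk {E F : VBundle (Σ i, Y i)} {φ : ∀ x, E.fib x →ₗ[ℂ] F.fib x}
    (h : ∀ i, IsContFam (E.pullback (Sigma.mk i) continuous_sigmaMk)
      (F.pullback (Sigma.mk i) continuous_sigmaMk) id id fun y => φ ⟨i, y⟩) :
    IsContFam E F id id φ := by
  refine of_openCover Sigma.mk (fun i => Topology.IsOpenEmbedding.sigmaMk)
    (fun x => ⟨x.1, x.2, rfl⟩) fun i => ?_
  exact (id_of_pullback F continuous_sigmaMk).comp
    ((h i).comp (id_to_pullback E continuous_sigmaMk) continuous_id) continuous_id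

end IsContFam

namespace TBundle

variable {T : Type*} [Group T] [TopologicalSpace T] {ι : Type*} {Y : ι → Type*}
  [∀ i, TopologicalSpace (Y i)] [∀ i, MulAction T (Y i)]

/-- The action on the fibres of `TBundle.sigma`. -/
def sigmaAct (E : ∀ i, TBundle T (Y i)) (t : T) {x x' : Σ i, Y i} (h : t • x = x') :
    (E x.1).fib x.2 →ₗ[ℂ] (E x'.1).fib x'.2 :=
  match x', h with
  | _, rfl => (E x.1).act t rfl

theorem sigmaAct_mk (E : ∀ i, TBundle T (Y i)) (t : T) {i : ι} {y y' : Y i} (h : t • y = y') :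
    sigmaAct E t (x := ⟨i, y⟩) (x' := ⟨i, y'⟩) (congrArg (Sigma.mk i) h) = (E i).act t h := by
  subst h
  rfl

/-- The equivariant bundle on a disjoint union with restriction `E i` to the `i`-th summand. -/
def sigma [∀ i, ContinuousSMul T (Y i)] (E : ∀ i, TBundle T (Y i)) : TBundle T (Σ i, Y i) where
  toVBundle := VBundle.sigma fun i => (E i).toVBundle
  act := sigmaAct E
  act_one := by
    rintro ⟨i, y⟩ _ v
    exact (LinearMap.congr_fun (sigmaAct_mk E 1 (one_smul T y)) v).trans ((E i).act_one y _ v)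
  act_mul s t := by
    rintro ⟨i, y⟩ _ _ rfl rfl _ v
    exact (LinearMap.congr_fun (sigmaAct_mk E (s * t) (mul_smul s t y)) v).trans
      ((E i).act_mul s t y _ _ rfl rfl _ v)
  continuous_act := by
    refine IsContFam.of_openCover (fun i => Prod.map id (Sigma.mk i))
      (fun i => Topology.IsOpenEmbedding.id.prodMap Topology.IsOpenEmbedding.sigmaMk)
      (fun p => ⟨p.2.1, (p.1, p.2.2), rfl⟩) fun i => ?_
    have hsmul : Continuous fun p : T × Y i => p.1 • p.2 := continuous_smul
    have hdown := (IsContFam.id_of_sigma (fun i => (E i).toVBundle) i).param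
      (continuous_snd (X := T))
    have hup := (IsContFam.id_to_sigma (fun i => (E i).toVBundle) i).param hsmul
    exact hup.comp ((E i).continuous_act.comp hdown continuous_snd) hsmul

namespace Iso

variable [∀ i, ContinuousSMul T (Y i)]

/-- The `i`-th restriction of `TBundle.sigma E` is `E i`. -/
def sigmaPullback (E : ∀ i, TBundle T (Y i)) (i : ι) :
    Iso ((sigma E).pullback (Sigma.mk i) continuous_sigmaMk fun _ _ => rfl) (E i) where
  toEquiv y := LinearEquiv.refl ℂ ((E i).fib y)
  equivariant t _ _ h v := LinearMap.congr_fun (sigmaAct_mk E t h) v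
  continuous_toEquiv := by
    exact (IsContFam.id_of_sigma (fun i => (E i).toVBundle) i).comp
      (IsContFam.id_of_pullback (sigma E).toVBundle continuous_sigmaMk) continuous_sigmaMk
  continuous_symm := by
    exact (IsContFam.id_to_pullback (sigma E).toVBundle continuous_sigmaMk).comp
      (IsContFam.id_to_sigma (fun i => (E i).toVBundle) i) continuous_sigmaMk

/-- Isomorphisms over the summands of a disjoint union glue. -/
def ofPullbackSigmaMk {E F : TBundle T (Σ i, Y i)}
    (e : ∀ i, Iso (E.pullback (Sigma.mk i) continuous_sigmaMk fun _ _ => rfl)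
      (F.pullback (Sigma.mk i) continuous_sigmaMk fun _ _ => rfl)) : Iso E F where
  toEquiv x := (e x.1).toEquiv x.2
  equivariant t x x' h v := by
    subst h
    exact (e x.1).equivariant t x.2 (t • x.2) rfl v
  continuous_toEquiv := IsContFam.of_pullback_sigmaMk fun i => (e i).continuous_toEquiv
  continuous_symm := IsContFam.of_pullback_sigmaMk fun i => (e i).continuous_symm

end Iso

end TBundle

section GrothendieckGroup

open Algebra GrothendieckAddGroup

variable {M : Type*} [AddCommMonoid M]

theorem grothendieckAddGroup_of_eq_of_iff {a b : M} :
    GrothendieckAddGroup.of a = GrothendieckAddGroup.of b ↔ ∃ c, c + a = c + b := by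
  simpa using (AddLocalization.addMonoidOf (⊤ : AddSubmonoid M)).eq_iff_exists (x := a) (y := b)

theorem bijective_pi_grothendieckLift {ι : Type*} {N : ι → Type*} [∀ i, AddCommMonoid (N i)]
    (φ : ∀ i, M →+ N i) (hφ : Function.Bijective fun m i => φ i m) :
    Function.Bijective fun x i =>
      GrothendieckAddGroup.lift (GrothendieckAddGroup.of.comp (φ i)) x := by
  have hsub (a b : M) (i : ι) : GrothendieckAddGroup.lift (GrothendieckAddGroup.of.comp (φ i))
      (GrothendieckAddGroup.of a - GrothendieckAddGroup.of b) =
        GrothendieckAddGroup.of (φ i a) - GrothendieckAddGroup.of (φ i b) := by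
    rw [map_sub, lift_of, lift_of]
    rfl
  refine ⟨(injective_iff_map_eq_zero
    (AddMonoidHom.pi fun i => GrothendieckAddGroup.lift (GrothendieckAddGroup.of.comp (φ i)))).2
      fun x hx => ?_, fun y => ?_⟩
  · obtain ⟨a, b, rfl⟩ := exists_sub x
    have hstable : ∀ i, ∃ c, c + φ i a = c + φ i b := fun i =>
      grothendieckAddGroup_of_eq_of_iff.1 (sub_eq_zero.1 ((hsub a b i).symm.trans (congrFun hx i)))
    choose c hc using hstable
    obtain ⟨m, rfl⟩ := hφ.surjective c
    have hab : m + a = m + b :=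
      hφ.injective (funext fun i => by simpa only [map_add] using hc i)
    exact sub_eq_zero.2 (grothendieckAddGroup_of_eq_of_iff.2 ⟨m, hab⟩)
  · choose a b hab using fun i => exists_sub (y i)
    obtain ⟨m, rfl⟩ := hφ.surjective a
    obtain ⟨m', rfl⟩ := hφ.surjective b
    exact ⟨GrothendieckAddGroup.of m - GrothendieckAddGroup.of m',
      funext fun i => (hsub m m' i).trans (hab i).symm⟩

end GrothendieckGroup

namespace Vect

variable {T X Y Z : Type*} [Group T] [TopologicalSpace T] [TopologicalSpace X]
  [TopologicalSpace Y] [TopologicalSpace Z] [MulAction T X] [MulAction T Y] [MulAction T Z]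

theorem pullback_pullback {f : Y → X} (hf : Continuous f) (hf' : ∀ (t : T) y, f (t • y) = t • f y)
    {g : Z → Y} (hg : Continuous g) (hg' : ∀ (t : T) z, g (t • z) = t • g z) (V : Vect T X) :
    pullback g hg hg' (pullback f hf hf' V) = pullback (fun z => f (g z)) (hf.comp hg)
      (fun t z => (congrArg f (hg' t z)).trans (hf' t (g z))) V := by
  induction V using Quotient.ind
  rfl

theorem pullback_eq_self {f : X → X} (hf : Continuous f) (hf' : ∀ (t : T) x, f (t • x) = t • f x)
    (hid : ∀ x, f x = x) (V : Vect T X) : pullback f hf hf' V = V := by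
  obtain rfl : f = id := funext hid
  induction V using Quotient.ind
  rfl

theorem bijective_pullback_homeomorph (e : Y ≃ₜ X) (he : ∀ (t : T) y, e (t • y) = t • e y) :
    Function.Bijective (pullback e e.continuous he) := by
  have he_symm (t : T) (x : X) : e.symm (t • x) = t • e.symm x := by
    rw [e.symm_apply_eq, he, e.apply_symm_apply]
  refine Function.bijective_iff_has_inverse.2
    ⟨pullback e.symm e.symm.continuous he_symm, fun V => ?_, fun V => ?_⟩
  · exact (pullback_pullback ..).trans (pullback_eq_self _ _ e.apply_symm_apply V)
  · exact (pullback_pullback ..).trans (pullback_eq_self _ _ e.symm_apply_apply V)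

section Sigma

variable {ι : Type*} {U : ι → Type*} [∀ i, TopologicalSpace (U i)] [∀ i, MulAction T (U i)]
  [∀ i, ContinuousSMul T (U i)]

theorem bijective_pullback_sigmaMk : Function.Bijective fun (V : Vect T (Σ i, U i)) i =>
    pullback (Sigma.mk i) continuous_sigmaMk (fun _ _ => rfl) V := by
  refine ⟨fun V V' h => ?_, fun V => ?_⟩
  · induction V, V' using Quotient.ind₂ with | _ E F
    have e (i : ι) : Nonempty (TBundle.Iso
        (E.pullback (Sigma.mk i) continuous_sigmaMk fun _ _ => rfl)
        (F.pullback (Sigma.mk i) continuous_sigmaMk fun _ _ => rfl)) :=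
      Quotient.exact (congrFun h i)
    exact Quotient.sound ⟨TBundle.Iso.ofPullbackSigmaMk fun i => (e i).some⟩
  · refine ⟨Quotient.mk _ (TBundle.sigma fun i => (V i).out), funext fun i => ?_⟩
    have e := TBundle.Iso.sigmaPullback (fun i => (V i).out) i
    exact (Quotient.sound (s := TBundle.setoid T (U i)) ⟨e⟩).trans (Quotient.out_eq (V i))

theorem bijective_pullback_of_sigma_homeomorph (e : (Σ i, U i) ≃ₜ X)
    (he : ∀ (t : T) u, e (t • u) = t • e u) : Function.Bijective fun (V : Vect T X) i =>
      pullback (fun u => e ⟨i, u⟩) (e.continuous.comp continuous_sigmaMk) (fun t u => he t ⟨i, u⟩)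
        V := by
  convert bijective_pullback_sigmaMk.comp (bijective_pullback_homeomorph e he) using 1
  funext V i
  exact (pullback_pullback ..).symm

end Sigma

end Vect

theorem KT.bijective_pullback_of_sigma_homeomorph {T X ι : Type*} {U : ι → Type*} [Group T]
    [TopologicalSpace T] [TopologicalSpace X] [MulAction T X] [∀ i, TopologicalSpace (U i)]
    [∀ i, MulAction T (U i)] [∀ i, ContinuousSMul T (U i)] (e : (Σ i, U i) ≃ₜ X)
    (he : ∀ (t : T) u, e (t • u) = t • e u) : Function.Bijective fun (x : KT T X) i =>
      KT.pullback (fun u => e ⟨i, u⟩) (e.continuous.comp continuous_sigmaMk)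
        (fun t u => he t ⟨i, u⟩) x :=
  bijective_pi_grothendieckLift
    (fun i => (Vect.pullback (fun u => e ⟨i, u⟩) (e.continuous.comp continuous_sigmaMk)
      fun t u => he t ⟨i, u⟩).toAddMonoidHom)
    (Vect.bijective_pullback_of_sigma_homeomorph e he)

/-- A space is the disjoint union of the fibres of a continuous map to a discrete space. -/
def sigmaFiberHomeomorph {X ι : Type*} [TopologicalSpace X] [TopologicalSpace ι]
    [DiscreteTopology ι] {f : X → ι} (hf : Continuous f) : (Σ i, {x // f x = i}) ≃ₜ X :=
  (Equiv.sigmaFiberEquiv f).toHomeomorphOfContinuousOpen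
    (continuous_sigma fun _ => continuous_subtype_val)
    (isOpenMap_sigma.2 fun i => ((isOpen_discrete {i}).preimage hf).isOpenMap_subtype_val)

namespace FixedSet

variable {T M : Type*} [CommGroup T] [TopologicalSpace T] [TopologicalSpace M] [MulAction T M]

section DiscreteComponents

variable [DiscreteTopology (ConnectedComponents (FixedSet T M))]

theorem Component.bijective_pi_restrict :
    Function.Bijective (RingHom.pi (Component.restrict (T := T) (M := M))) :=
  KT.bijective_pullback_of_sigma_homeomorph (U := Component)
    (sigmaFiberHomeomorph (ConnectedComponents.continuous_coe (α := FixedSet T M)))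
    fun _ _ => rfl

/-- The decomposition `K_T(M^T) ≅ ∏ W, K_T(W)` over the components `W` of `M^T`. -/
def restrictEquiv :
    KT T (FixedSet T M) ≃+* ∀ W : ConnectedComponents (FixedSet T M), KT T (Component W) :=
  RingEquiv.ofBijective (RingHom.pi Component.restrict) Component.bijective_pi_restrict

theorem Component.restrict_restrictEquiv_symm
    (y : ∀ W : ConnectedComponents (FixedSet T M), KT T (Component W))
    (W : ConnectedComponents (FixedSet T M)) : Component.restrict W (restrictEquiv.symm y) = y W :=
  congrFun (restrictEquiv.apply_symm_apply y) W

end DiscreteComponents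

end FixedSet
open Module

theorem eq_of_forall_rTensor_eq {R P A ι : Type*} {Q : ι → Type*} [CommRing R] [AddCommGroup P]
    [Module R P] [AddCommGroup A] [Module R A] [Module.Free R A] [∀ i, AddCommGroup (Q i)]
    [∀ i, Module R (Q i)] {f : ∀ i, P →ₗ[R] Q i}
    (hf : ∀ x y, (∀ i, f i x = f i y) → x = y) {x y : P ⊗[R] A}
    (hxy : ∀ i, (f i).rTensor A x = (f i).rTensor A y) : x = y := by
  classical
  let b := Module.Free.chooseBasis R A
  have hcoeff (i k) (z : P ⊗[R] A) :
      TensorProduct.equivFinsuppOfBasisRight b ((f i).rTensor A z) k =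
        f i (TensorProduct.equivFinsuppOfBasisRight b z k) := by
    induction z with
    | zero => simp
    | add z z' hz hz' => simp only [map_add, Finsupp.add_apply, hz, hz']
    | tmul p a =>
      simp only [LinearMap.rTensor_tmul, TensorProduct.equivFinsuppOfBasisRight_apply_tmul_apply,
        map_smul]
  refine (TensorProduct.equivFinsuppOfBasisRight b).injective (Finsupp.ext fun k => ?_)
  exact hf _ _ fun i => by rw [← hcoeff, ← hcoeff, hxy]

section TwistedProduct

variable {G K V : Type*} [CommSemiring K] [AddCommMonoid V] [Module K V]

/-- The `K`-bilinear product on a module with basis `B` indexed by `G` for which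
`B s * B t = c s t • B (s * t)`: that of the twisted monoid algebra when `c` is a `2`-cocycle. -/
def twistedProduct [Mul G] (B : Basis G K V) (c : G → G → K) : V →ₗ[K] V →ₗ[K] V :=
  B.constr K fun s => B.constr K fun t => c s t • B (s * t)

theorem twistedProduct_basis [Mul G] (B : Basis G K V) (c : G → G → K) (s t : G) :
    twistedProduct B c (B s) (B t) = c s t • B (s * t) := by
  simp only [twistedProduct, Basis.constr_basis]

theorem twistedProduct_comm [CommMagma G] (B : Basis G K V) {c : G → G → K}
    (hc : ∀ s t, c s t = c t s) (x y : V) : twistedProduct B c x y = twistedProduct B c y x := by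
  have hflip : twistedProduct B c = (twistedProduct B c).flip :=
    LinearMap.ext_basis B B fun s t => by
      rw [LinearMap.flip_apply, twistedProduct_basis, twistedProduct_basis, hc, mul_comm]
  exact LinearMap.congr_fun₂ hflip x y

theorem twistedProduct_assoc [Semigroup G] (B : Basis G K V) {c : G → G → K}
    (hc : ∀ r s t, c r s * c (r * s) t = c s t * c r (s * t)) (x y z : V) :
    twistedProduct B c (twistedProduct B c x y) z =
      twistedProduct B c x (twistedProduct B c y z) := by
  let P := twistedProduct B c
  have hassoc : P.compr₂ P = (LinearMap.llcomp K V V V ∘ₗ P).compl₂ P :=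
    LinearMap.ext_basis B B fun r s => B.ext fun t => by
      simp only [P, LinearMap.compr₂_apply, LinearMap.compl₂_apply, LinearMap.comp_apply,
        LinearMap.llcomp_apply, twistedProduct_basis, map_smul, LinearMap.smul_apply, smul_smul,
        hc, mul_assoc]
  exact LinearMap.congr_fun (LinearMap.congr_fun₂ hassoc x y) z

theorem twistedProduct_one_left [MulOneClass G] (B : Basis G K V) {c : G → G → K}
    (hc : ∀ t, c 1 t = 1) (x : V) : twistedProduct B c (B 1) x = x := by
  have hid : twistedProduct B c (B 1) = LinearMap.id := B.ext fun t => by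
    rw [twistedProduct_basis, hc, one_mul, one_smul, LinearMap.id_apply]
  exact LinearMap.congr_fun hid x

end TwistedProduct

theorem linearIndependent_of_common_eigenvectors {G k V ι : Type*} [Monoid G] [Field k]
    [AddCommGroup V] [Module k V] {f : G → End k V} {χ : ι → G →* k}
    (hχ : Function.Injective χ) {v : ι → V} (hv : ∀ i g, f g (v i) = χ i g • v i)
    (hv₀ : ∀ i, v i ≠ 0) : LinearIndependent k v := by
  have hchar : LinearIndependent k fun i g => χ i g := (linearIndependent_monoidHom G k).comp χ hχ
  rw [linearIndependent_iff'] at hchar ⊢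
  intro s a ha i hi
  -- Applying `φ` to the relation turns it into a relation between the characters `χ j`.
  have hdual (φ : Dual k V) : a i * φ (v i) = 0 := by
    refine hchar s (fun j => a j * φ (v j)) (funext fun g => ?_) i hi
    calc (∑ j ∈ s, (a j * φ (v j)) • fun g => χ j g) g = φ (f g (∑ j ∈ s, a j • v j)) := by
          simp only [Finset.sum_apply, Pi.smul_apply, map_sum, map_smul, hv, smul_eq_mul]
          exact Finset.sum_congr rfl fun j _ => by ring
      _ = 0 := by rw [ha, map_zero, map_zero]
  obtain ⟨φ, hφ⟩ := not_forall.1 (mt (forall_dual_apply_eq_zero_iff k (v i)).1 (hv₀ i))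
  exact (mul_eq_zero.1 (hdual φ)).resolve_right hφ

theorem VBundle.finite_fib {X : Type*} [TopologicalSpace X] (E : VBundle X) (x : X) :
    Module.Finite ℂ (E.fib x) :=
  Module.Finite.of_basis (E.frame x x (E.mem_nhd x))

theorem VBundle.isLocallyConstant_finrank {X : Type*} [TopologicalSpace X] (E : VBundle X) :
    IsLocallyConstant fun x => finrank ℂ (E.fib x) :=
  (IsLocallyConstant.iff_exists_open _).2 fun x =>
    ⟨E.nhd x, E.isOpen_nhd x, E.mem_nhd x, fun y hy =>
      (finrank_eq_nat_card_basis (E.frame x y hy)).trans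
        (finrank_eq_nat_card_basis (E.frame x x (E.mem_nhd x))).symm⟩

theorem VBundle.nontrivial_fib {X : Type*} [TopologicalSpace X] [PreconnectedSpace X]
    (E : VBundle X) {x : X} (hx : Nontrivial (E.fib x)) (y : X) : Nontrivial (E.fib y) := by
  have := E.finite_fib
  have hrank := E.isLocallyConstant_finrank.apply_eq_of_preconnectedSpace x y
  exact nontrivial_of_finrank_pos (R := ℂ) (hrank ▸ finrank_pos)

theorem TBundle.finite_setOf_nontrivial_isotypic {T X : Type*} [Group T] [TopologicalSpace T]
    [IsTopologicalGroup T] [CompactSpace T] [TopologicalSpace X] [PreconnectedSpace X]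
    [MulAction T X] (E : TBundle T X) (htriv : ∀ (t : T) (x : X), t • x = x) :
    {μ : T →ₜ* Circle | ∃ x, Nontrivial ((E.isotypic htriv μ).fib x)}.Finite := by
  rcases isEmpty_or_nonempty X with hX | ⟨⟨x⟩⟩
  · exact Set.finite_empty.subset fun μ ⟨x, _⟩ => hX.elim x
  let char (μ : T →ₜ* Circle) : T →* ℂ := Circle.coeHom.comp μ.toMonoidHom
  have hchar : Function.Injective char := fun μ ν h =>
    ContinuousMonoidHom.ext fun t => Circle.ext (DFunLike.congr_fun h t)
  have hweight : ∀ μ : {μ : T →ₜ* Circle | ∃ x, Nontrivial ((E.isotypic htriv μ).fib x)},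
      ∃ v ∈ E.weightSpace htriv μ x, v ≠ 0 := by
    rintro ⟨μ, y, hy⟩
    have hx : Nontrivial (E.weightSpace htriv μ x) :=
      (E.isotypic htriv μ).toVBundle.nontrivial_fib hy x
    exact Submodule.exists_mem_ne_zero_of_ne_bot ((Submodule.nontrivial_iff_ne_bot).1 hx)
  choose v hv hv₀ using hweight
  have := E.finite_fib x
  exact (linearIndependent_of_common_eigenvectors (f := fun t => E.act t (htriv t x))
    (hchar.comp Subtype.val_injective) hv hv₀).finite

theorem logWeight_one {T : Type*} [Group T] [TopologicalSpace T] (μ : T →ₜ* Circle) :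
    logWeight μ 1 = 0 := by
  simp [logWeight]

theorem twistExponent_one_left {T : Type*} [Group T] [TopologicalSpace T] (μ : T →ₜ* Circle)
    (t : T) : twistExponent μ 1 t = 0 := by
  simp [twistExponent, logWeight_one]

theorem twistExponent_comm {T : Type*} [CommGroup T] [TopologicalSpace T] (μ : T →ₜ* Circle)
    (s t : T) : twistExponent μ s t = twistExponent μ t s := by
  simp only [twistExponent, mul_comm s t, add_comm (logWeight μ s)]

theorem twistExponent_cocycle {T : Type*} [Group T] [TopologicalSpace T] (μ : T →ₜ* Circle)
    (r s t : T) : twistExponent μ r s + twistExponent μ (r * s) t =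
      twistExponent μ s t + twistExponent μ r (s * t) := by
  rify
  simp only [twistExponent_eq, mul_assoc]
  ring

theorem linearMap_ext_tmul_basis {R P A N ι : Type*} [CommSemiring R] [AddCommMonoid P]
    [Module R P] [AddCommMonoid A] [Module R A] [AddCommMonoid N] [Module R N] (b : Basis ι R A)
    {f g : P ⊗[R] A →ₗ[R] N} (h : ∀ p i, f (p ⊗ₜ b i) = g (p ⊗ₜ b i)) : f = g :=
  TensorProduct.ext (LinearMap.ext fun p => b.ext (h p))

section StarModule

variable {T X : Type*} [CommGroup T] [TopologicalSpace T] [TopologicalSpace X] [MulAction T X]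

variable (T X) in
/-- The `K_T(X)`-basis `(1 ⊗ t)_t` of `K_T(X) ⊗ ℤ[T]`. -/
def StarModule.basis : Basis T (KT T X) (StarModule T X) :=
  (MonoidAlgebra.basis T ℤ).baseChange (KT T X)

theorem StarModule.basis_apply (t : T) : StarModule.basis T X t = pureTensor 1 t := by
  rw [basis, Basis.baseChange_apply, MonoidAlgebra.basis_apply]
  rfl

theorem smul_pureTensor (ρ σ : KT T X) (t : T) :
    ρ • pureTensor σ t = pureTensor (ρ * σ) t :=
  rfl

theorem pureTensor_eq_smul_basis (σ : KT T X) (t : T) :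
    pureTensor σ t = σ • StarModule.basis T X t := by
  rw [StarModule.basis_apply, smul_pureTensor, mul_one]

theorem StarModule.linearMap_ext {N : Type*} [AddCommGroup N] {f g : StarModule T X →ₗ[ℤ] N}
    (h : ∀ σ t, f (pureTensor σ t) = g (pureTensor σ t)) : f = g :=
  linearMap_ext_tmul_basis (MonoidAlgebra.basis T ℤ) fun σ t => by
    rw [MonoidAlgebra.basis_apply]
    exact h σ t

theorem twistedProduct_pureTensor (c : T → T → KT T X) (σ τ : KT T X) (s t : T) :
    twistedProduct (StarModule.basis T X) c (pureTensor σ s) (pureTensor τ t) =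
      pureTensor (σ * τ * c s t) (s * t) := by
  simp only [pureTensor_eq_smul_basis, map_smul, LinearMap.smul_apply, twistedProduct_basis,
    smul_smul, mul_assoc]
  rw [mul_left_comm]

end StarModule

instance FixedSet.Component.instConnectedSpace {T M : Type*} [CommGroup T] [TopologicalSpace M]
    [MulAction T M] (W : ConnectedComponents (FixedSet T M)) :
    ConnectedSpace (Component W) := by
  obtain ⟨x, rfl⟩ := ConnectedComponents.surjective_coe W
  suffices h : IsConnected (ConnectedComponents.mk ⁻¹' {ConnectedComponents.mk x}) from
    isConnected_iff_connectedSpace.1 h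
  rw [connectedComponents_preimage_singleton]
  exact isConnected_connectedComponent

open FixedSet in
theorem StarModule.ext_restrict {T M : Type*} [CommGroup T] [TopologicalSpace T]
    [TopologicalSpace M] [MulAction T M] [DiscreteTopology (ConnectedComponents (FixedSet T M))]
    {x y : StarModule T (FixedSet T M)}
    (h : ∀ W : ConnectedComponents (FixedSet T M),
      (Component.restrict W).toIntAlgHom.toLinearMap.rTensor (MonoidAlgebra ℤ T) x =
        (Component.restrict W).toIntAlgHom.toLinearMap.rTensor (MonoidAlgebra ℤ T) y) : x = y :=
  eq_of_forall_rTensor_eq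
    (fun _ _ hW => Component.bijective_pi_restrict.injective (funext hW)) h

namespace StableComplexStructure

open FixedSet

variable {n : ℕ} {T M : Type*} [CommGroup T] [TopologicalSpace T] [CompactSpace T]
  [TopologicalSpace M] [ChartedSpace (EuclideanSpace ℝ (Fin n)) M] [IsManifold (𝓡 n) ∞ M]
  [MulAction T M] (S : StableComplexStructure n T M)
  (d : ℕ) [ChartedSpace (EuclideanSpace ℝ (Fin d)) T] [LieGroup (𝓡 d) ∞ T]
  [ContMDiffSMul (𝓡 d) (𝓡 n) ∞ T M]

theorem finite_normalWeights (W : ConnectedComponents (FixedSet T M)) :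
    (S.normalWeights d W).Finite :=
  haveI : IsTopologicalGroup T := topologicalGroup_of_lieGroup (𝓡 d) ∞
  (S.normalBundle d W).finite_setOf_nontrivial_isotypic Component.smul_eq

theorem twistClass_one_left (W : ConnectedComponents (FixedSet T M)) (t : T) :
    S.twistClass d W 1 t = 1 := by
  simp only [twistClass, twistExponent_one_left, pow_zero, finprod_mem_one]

theorem twistClass_comm (W : ConnectedComponents (FixedSet T M)) (s t : T) :
    S.twistClass d W s t = S.twistClass d W t s := by
  simp only [twistClass, twistExponent_comm _ s t]

theorem twistClass_cocycle (W : ConnectedComponents (FixedSet T M)) (r s t : T) :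
    S.twistClass d W r s * S.twistClass d W (r * s) t =
      S.twistClass d W s t * S.twistClass d W r (s * t) := by
  have hfin := S.finite_normalWeights d W
  simp only [twistClass, ← finprod_mem_mul_distrib hfin, ← pow_add, twistExponent_cocycle]

variable [DiscreteTopology (ConnectedComponents (FixedSet T M))]

/-- The class on `M^T` that restricts to `twistClass` on each component. -/
def twist (s t : T) : KT T (FixedSet T M) :=
  restrictEquiv.symm fun W => S.twistClass d W s t

theorem restrict_twist (W : ConnectedComponents (FixedSet T M)) (s t : T) :
    Component.restrict W (S.twist d s t) = S.twistClass d W s t :=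
  Component.restrict_restrictEquiv_symm _ W

theorem twist_one_left (t : T) : S.twist d 1 t = 1 := by
  simp only [twist, twistClass_one_left]
  exact map_one restrictEquiv.symm

theorem twist_comm (s t : T) : S.twist d s t = S.twist d t s := by
  simp only [twist, S.twistClass_comm d _ s t]

theorem twist_cocycle (r s t : T) :
    S.twist d r s * S.twist d (r * s) t = S.twist d s t * S.twist d r (s * t) := by
  simp only [twist, ← map_mul]
  exact congrArg _ (funext fun W => S.twistClass_cocycle d W r s t)

theorem isStarProduct_twistedProduct : S.IsStarProduct d
    ((twistedProduct (StarModule.basis T (FixedSet T M)) (S.twist d)).restrictScalars₁₂ ℤ ℤ) := by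
  intro W σ τ s t
  rw [LinearMap.restrictScalars₁₂_apply_apply, twistedProduct_pureTensor, ← S.restrict_twist d,
    ← map_mul, ← map_mul]
  rfl

theorem isStarProduct_iff {star : StarModule T (FixedSet T M) →ₗ[ℤ]
    StarModule T (FixedSet T M) →ₗ[ℤ] StarModule T (FixedSet T M)} :
    S.IsStarProduct d star ↔ star =
      (twistedProduct (StarModule.basis T (FixedSet T M)) (S.twist d)).restrictScalars₁₂ ℤ ℤ := by
  refine ⟨fun h => ?_, fun h => h ▸ S.isStarProduct_twistedProduct d⟩
  refine StarModule.linearMap_ext fun σ s => StarModule.linearMap_ext fun τ t => ?_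
  exact StarModule.ext_restrict fun W =>
    (h W σ τ s t).trans (S.isStarProduct_twistedProduct d W σ τ s t).symm

end StableComplexStructure

end

end EquivK

open EquivK in
theorem mainTheorem9_general {d n : ℕ} {T M : Type*} [CommGroup T] [TopologicalSpace T]
    [CompactSpace T] [ChartedSpace (EuclideanSpace ℝ (Fin d)) T] [LieGroup (𝓡 d) ∞ T]
    [TopologicalSpace M] [ChartedSpace (EuclideanSpace ℝ (Fin n)) M] [IsManifold (𝓡 n) ∞ M]
    [MulAction T M] [ContMDiffSMul (𝓡 d) (𝓡 n) ∞ T M] (S : StableComplexStructure n T M)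
    [DiscreteTopology (ConnectedComponents (FixedSet T M))] :
    (∃! star, S.IsStarProduct d star) ∧
    ∀ star, S.IsStarProduct d star →
      (∀ x y, star x y = star y x) ∧
      (∀ x y z, star (star x y) z = star x (star y z)) ∧
      (∀ x, star (pureTensor 1 1) x = x ∧ star x (pureTensor 1 1) = x) ∧
      (∀ (r : KT T PUnit.{1}) x y,
        star (r • x) y = r • star x y ∧ star x (r • y) = r • star x y) := by
  simp only [S.isStarProduct_iff d]
  refine ⟨⟨_, rfl, fun _ h => h⟩, ?_⟩
  rintro star rfl
  let B := StarModule.basis T (FixedSet T M)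
  have comm := twistedProduct_comm B (S.twist_comm d)
  have assoc := twistedProduct_assoc B (S.twist_cocycle d)
  have one_left (x) : twistedProduct B (S.twist d) (pureTensor 1 1) x = x := by
    rw [← StarModule.basis_apply]
    exact twistedProduct_one_left B (S.twist_one_left d) x
  have smul_right (r : KT T PUnit.{1}) (x y) :=
    (twistedProduct B (S.twist d) x).map_smul_of_tower r y
  have smul_left (r : KT T PUnit.{1}) (x y) :=
    LinearMap.congr_fun ((twistedProduct B (S.twist d)).map_smul_of_tower r x) y
  exact ⟨comm, assoc, fun x => ⟨one_left x, (comm _ _).trans (one_left x)⟩,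
    fun r x y => ⟨smul_left r x y, smul_right r x y⟩⟩

theorem mainTheorem9 {d n : ℕ} {T : Type*} {M : Type*}
    [CommGroup T] [TopologicalSpace T] [T2Space T] [CompactSpace T] [ConnectedSpace T]
    [ChartedSpace (EuclideanSpace ℝ (Fin d)) T] [LieGroup (𝓡 d) ∞ T]
    [TopologicalSpace M] [T2Space M] [SecondCountableTopology M]
    [ChartedSpace (EuclideanSpace ℝ (Fin n)) M] [IsManifold (𝓡 n) ∞ M]
    [MulAction T M] [ContMDiffSMul (𝓡 d) (𝓡 n) ∞ T M]
    (S : EquivK.StableComplexStructure n T M) [Finite (ConnectedComponents (EquivK.FixedSet T M))] :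
    (∃! star, S.IsStarProduct d star) ∧
    ∀ star, S.IsStarProduct d star →
      (∀ x y, star x y = star y x) ∧
      (∀ x y z, star (star x y) z = star x (star y z)) ∧
      (∀ x, star (EquivK.pureTensor 1 1) x = x ∧ star x (EquivK.pureTensor 1 1) = x) ∧
      (∀ (r : EquivK.KT T PUnit.{1}) x y,
        star (r • x) y = r • star x y ∧ star x (r • y) = r • star x y) :=
  mainTheorem9_general S
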